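/- Let $G$ be a countably infinite group and let $\Omega$ be the Cantor space. Equip $\mathrm{Homeo}(\Omega)$ with the topology of uniform convergence and the set $\Xi(G)=\mathrm{Hom}(G,\mathrm{Homeo}(\Omega))$ of actions of $G$ on $\Omega$ with the subspace topology from $\mathrm{Homeo}(\Omega)^G$. Let $\Xi_{\min}(G)\subseteq\Xi(G)$ be the subspace of minimal actions (those all of whose orbits are dense). The conjugacy class of $\xi$ is $\{f\xi(\cdot)f^{-1} : f\in\mathrm{Homeo}(\Omega)\}$. For a finite set $A$ (an alphabet), let $A^G$ carry the product topology, with $A$ discrete, and the left shift $(g\cdot x)(h)=x(g^{-1}h)$. Let $\mathcal S_{\min}(A^G)$ be the space of minimal subshifts of $A^G$, that is, of non-empty closed shift-invariant subsets $X\subseteq A^G$ in which every orbit is dense, with the Vietoris topology. A subshift $X\in\mathcal S_{\min}(A^G)$ is projectively isolated in $\mathcal S_{\min}(A^G)$ if there exist a finite alphabet $B$, a continuous $G$-equivariant surjection $\Phi\colon B^G\to A^G$ and a non-empty open set $\mathcal U\subseteq\mathcal S_{\min}(B^G)$ such that $\Phi[Y]=X$ for every $Y\in\mathcal U$. Then the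 following are equivalent: 1. There is a conjugacy class in $\Xi_{\min}(G)$ that is comeager in $\Xi_{\min}(G)$. 2. For every finite alphabet $A$, the set of minimal subshifts that are projectively isolated in $\mathcal S_{\min}(A^G)$ is dense in $\mathcal S_{\min}(A^G)$. -/

import Mathlib

open TopologicalSpace

namespace GenericMinimal

section Actions

/-- The Cantor space. -/
abbrev Cantor : Type := ℕ → Bool

/-- The topology of uniform convergence on `Homeo(Ω)`. As `Ω` is compact, the topology of `C(Ω, Ω)`
(compact-open) is the topology of uniform convergence. -/
instance homeoTopology : TopologicalSpace (Cantor ≃ₜ Cantor) :=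
  TopologicalSpace.induced (fun f => (f : C(Cantor, Cantor))) inferInstance

/-- `Ξ(G) = Hom(G, Homeo(Ω))`, the space of actions of `G` on the Cantor space. The product in
`Homeo(Ω)` is composition. -/
def Xi (G : Type*) [Group G] : Type _ := G →* (Cantor ≃ₜ Cantor)

/-- `Ξ(G)` carries the subspace topology from the product `Homeo(Ω)^G`. -/
instance xiTopology (G : Type*) [Group G] : TopologicalSpace (Xi G) :=
  TopologicalSpace.induced (fun (ξ : G →* (Cantor ≃ₜ Cantor)) (g : G) => ξ g) Pi.topologicalSpace

/-- The action of `G` on the Cantor space given by a point of `Ξ(G)`. -/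
@[reducible]
def Xi.toMulAction {G : Type*} [Group G] (ξ : G →* (Cantor ≃ₜ Cantor)) : MulAction G Cantor where
  smul g ω := ξ g ω
  one_smul ω := by
    change ξ 1 ω = ω
    rw [map_one]
    rfl
  mul_smul g h ω := by
    change ξ (g * h) ω = ξ g (ξ h ω)
    rw [map_mul]
    rfl

/-- `Ξ_min(G)`: the minimal actions, i.e. those all of whose orbits are dense. -/
def XiMin (G : Type*) [Group G] : Set (Xi G) :=
  {ξ | @MulAction.IsMinimal G Cantor _ _ (Xi.toMulAction ξ)}

/-- The conjugate action `(f · ξ)(g) = f ξ(g) f⁻¹`. -/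
def Xi.conj {G : Type*} [Group G] (f : Cantor ≃ₜ Cantor) (ξ : G →* (Cantor ≃ₜ Cantor)) : Xi G :=
  (MulAut.conj f).toMonoidHom.comp ξ

/-- The conjugacy class of `ξ`: its orbit under conjugation by `Homeo(Ω)`. -/
def Xi.conjClass {G : Type*} [Group G] (ξ : Xi G) : Set (Xi G) :=
  Set.range fun f : Cantor ≃ₜ Cantor => Xi.conj f ξ

/-- `Ξ_min(G)` has a comeager conjugacy class (comeager in the subspace `Ξ_min(G)`). -/
def HasComeagerConjClassMin (G : Type*) [Group G] : Prop :=
  ∃ ξ ∈ XiMin G, (Subtype.val ⁻¹' Xi.conjClass ξ : Set (XiMin G)) ∈ residual (XiMin G)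

end Actions

section Subflows

/-- The space `S(Z)` of subflows of a `G`-flow `Z`: the non-empty closed (equivalently, as `Z` is
compact Hausdorff, compact) `G`-invariant subsets, with the subspace topology from the Vietoris
topology. -/
abbrev Subflow (G Z : Type*) [Group G] [TopologicalSpace Z] [MulAction G Z] : Type _ :=
  {K : NonemptyCompacts Z // ∀ (g : G), ∀ z ∈ K, g • z ∈ K}

/-- The restricted action on a subflow. -/
instance subflowAction {G Z : Type*} [Group G] [TopologicalSpace Z] [MulAction G Z]
    (X : Subflow G Z) : MulAction G X.1 where
  smul g z := ⟨g • z.1, X.2 g z.1 z.2⟩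
  one_smul z := Subtype.ext (one_smul G z.1)
  mul_smul g h z := Subtype.ext (mul_smul g h z.1)

/-- `S_min(Z)`: the minimal subflows of `Z`. -/
def SMin (G Z : Type*) [Group G] [TopologicalSpace Z] [MulAction G Z] : Set (Subflow G Z) :=
  {X | MulAction.IsMinimal G X.1}

end Subflows

section Shifts

/-- The full shift `A^G`. -/
def FullShift (G A : Type*) : Type _ := G → A

/-- The product topology, each copy of the alphabet being discrete. -/
instance fullShiftTopology (G A : Type*) : TopologicalSpace (FullShift G A) :=
  @Pi.topologicalSpace G (fun _ => A) (fun _ => ⊥)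

/-- The left shift `(g · x)(h) = x(g⁻¹h)`. -/
instance fullShiftAction (G A : Type*) [Group G] : MulAction G (FullShift G A) where
  smul g x := fun h => x (g⁻¹ * h)
  one_smul x := by
    funext h
    change x (1⁻¹ * h) = x h
    simp
  mul_smul g k x := by
    funext h
    change x ((g * k)⁻¹ * h) = x (k⁻¹ * (g⁻¹ * h))
    simp [mul_assoc]

/-- A factor map: an equivariant, continuous, surjective map. -/
structure IsFactorMap (G : Type*) {Z W : Type*} [Group G] [TopologicalSpace Z] [MulAction G Z]
    [TopologicalSpace W] [MulAction G W] (Φ : Z → W) : Prop where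
  continuous : Continuous Φ
  equivariant : ∀ (g : G) (z : Z), Φ (g • z) = g • Φ z
  surjective : Function.Surjective Φ

/-- `X` is projectively isolated in `S_min(A^G)`: for some finite alphabet `B`, some factor map
`Φ : B^G → A^G` and some non-empty open `U ⊆ S_min(B^G)`, one has `Φ[Y] = X` for all `Y ∈ U`. -/
def IsProjIsolatedMin {G : Type*} [Group G] {A : Type} (X : SMin G (FullShift G A)) : Prop :=
  ∃ (B : Type) (_ : Finite B) (Φ : FullShift G B → FullShift G A), IsFactorMap G Φ ∧
    ∃ U : Set (SMin G (FullShift G B)), IsOpen U ∧ U.Nonempty ∧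
      ∀ Y ∈ U, Φ '' (Y.1.1 : Set (FullShift G B)) = (X.1.1 : Set (FullShift G A))

end Shifts

end GenericMinimal

/-!
The link between the two conditions is the coding map: a minimal action `ξ` on the Cantor space,
together with a clopen labelling `π` of the Cantor space, generates a minimal subshift, the set of
`π`-itineraries of the points (`code`). An action is close to `ξ` when, for some fine labelling `σ`
and some finite `F ⊆ G`, both give the same `σ`-itineraries on `F`. Hence the subshift generated by
`π` varies continuously with the action. Call `π` *stable* at `ξ` if this subshift is constant near
`ξ`.

Flexibility comes from two facts. Every minimal subshift is generated by a labelling of a minimal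
action on the Cantor space, because its product with a free zero-dimensional flow (built from
`3`-colourings of `G`) contains minimal subflows, and these have no isolated points. And clopen
partitions with the same labels in two Cantor spaces are matched by a homeomorphism, so the new
action can be placed into any neighbourhood that is compatible with the finite patterns of the
subshift (`exists_cantor_realization`, `exists_cantor_code`). Consequently a subshift generated by a
stable labelling is projectively isolated (`isProjIsolatedMin_of_stable`), and, conversely, if
projectively isolated subshifts are dense, then every labelling is stable at a dense open set of
actions (`exists_stable`).

Suppose that some conjugacy class is comeager. There are only countably many labellings, so the
members of the class generate, with a fixed labelling `π`, only countably many subshifts, and each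
of these is attained on a closed set of actions. By Baire's theorem `π` is stable at some member of
every non-empty open set, and the generated subshifts are projectively isolated and dense.

Suppose that projectively isolated subshifts are dense. For a generic action all labellings are
stable. Two minimal actions that generate the same subshift have a joining over this subshift which
is again an action on the Cantor space and as close to the first one as desired
(`exists_cantor_joining`); stability passes to extensions (`Stable.comp`). This gives a further
generic property: whenever `π` generates the image of a subshift `S` that comes from a stable
labelling, `π` has a refinement that generates `S` (`residual_extends`). There are only countably
many such `S`, so the two properties together are generic, and they let a back-and-forth argument
conjugate any two generic actions to each other (`Generic.conj`).
-/

open Set Filter Topology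

namespace GenericMinimal

/-! ### Back-and-forth construction of homeomorphisms -/

section BackAndForth

variable {M N K : Type*} [TopologicalSpace M] [TopologicalSpace N] [TopologicalSpace K]

theorem continuous_of_isClosed_graph [CompactSpace N] {f : M → N}
    (hf : IsClosed {p : M × N | p.2 = f p.1}) : Continuous f := by
  refine continuous_iff_isClosed.2 fun s hs => ?_
  have h := isClosedMap_fst_of_compactSpace (X := M) (Y := N) _
    (hf.inter (hs.preimage continuous_snd))
  convert h using 1
  ext x
  simp

/-- The limit of a compatible sequence of approximations `q n : M → K`, `ρ n : N → K` of a
homeomorphism: if the `q n` and `ρ n` have equal ranges, become finer and finer, and separate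
points, then there is a homeomorphism matching all of them. -/
theorem exists_homeomorph_of_sequence [CompactSpace M] [CompactSpace N] [T2Space M] [T2Space N]
    [T2Space K] (q : ℕ → M → K) (ρ : ℕ → N → K) (hq : ∀ n, Continuous (q n))
    (hρ : ∀ n, Continuous (ρ n)) (hr : ∀ n, range (q n) = range (ρ n))
    (href : ∀ n x y, q (n + 1) x = ρ (n + 1) y → q n x = ρ n y)
    (hM : ∀ x x', (∀ n, q n x = q n x') → x = x')
    (hN : ∀ y y', (∀ n, ρ n y = ρ n y') → y = y') :
    ∃ f : M ≃ₜ N, ∀ n x, ρ n (f x) = q n x := by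
  have h1 : ∀ x, ∃ y, ∀ n, ρ n y = q n x := by
    intro x
    have := IsCompact.nonempty_iInter_of_sequence_nonempty_isCompact_isClosed
      (fun n => {y | ρ n y = q n x}) (fun n y hy => (href n x y (Eq.symm hy)).symm)
      (fun n => by
        have : q n x ∈ range (ρ n) := hr n ▸ mem_range_self x
        exact this)
      ((isClosed_eq (hρ 0) continuous_const).isCompact)
      (fun n => isClosed_eq (hρ n) continuous_const)
    obtain ⟨y, hy⟩ := this
    exact ⟨y, fun n => mem_iInter.1 hy n⟩
  have h2 : ∀ y, ∃ x, ∀ n, q n x = ρ n y := by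
    intro y
    have := IsCompact.nonempty_iInter_of_sequence_nonempty_isCompact_isClosed
      (fun n => {x | q n x = ρ n y}) (fun n x hx => href n x y hx)
      (fun n => by
        have : ρ n y ∈ range (q n) := hr n ▸ mem_range_self y
        exact this)
      ((isClosed_eq (hq 0) continuous_const).isCompact)
      (fun n => isClosed_eq (hq n) continuous_const)
    obtain ⟨y, hy⟩ := this
    exact ⟨y, fun n => mem_iInter.1 hy n⟩
  choose f hf using h1
  choose g hg using h2
  let e : M ≃ N :=
    { toFun := f
      invFun := g
      left_inv := fun x => hM _ _ fun n => by rw [hg, hf]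
      right_inv := fun y => hN _ _ fun n => by rw [hf, hg] }
  have hc : Continuous e := by
    apply continuous_of_isClosed_graph
    have : {p : M × N | p.2 = e p.1} = ⋂ n, {p : M × N | ρ n p.2 = q n p.1} := by
      ext p
      simp only [mem_ofPred_eq, mem_iInter]
      constructor
      · intro h n
        rw [h]
        exact hf _ n
      · intro h
        exact hN _ _ fun n => by rw [h n]; exact (hf _ n).symm
    rw [this]
    exact isClosed_iInter fun n =>
      isClosed_eq ((hρ n).comp continuous_snd) ((hq n).comp continuous_fst)
  exact ⟨hc.homeoOfEquivCompactToT2, fun n x => hf x n⟩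

/-- Zero-dimensional compact metrizable spaces have a sequence of clopen sets separating points. -/
theorem exists_clopen_sequence (M : Type*) [TopologicalSpace M] [CompactSpace M] [T2Space M]
    [TotallyDisconnectedSpace M] [SecondCountableTopology M] :
    ∃ s : ℕ → Set M, (∀ n, IsClopen (s n)) ∧ ∀ x x', (∀ n, x ∈ s n ↔ x' ∈ s n) → x = x' := by
  have : Countable (Clopens M) := Clopens.countable_iff_secondCountable.2 inferInstance
  obtain ⟨e, he⟩ := exists_surjective_nat (Clopens M)
  refine ⟨fun n => e n, fun n => (e n).isClopen, fun x x' h => ?_⟩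
  by_contra hne
  obtain ⟨U, hU, hx, hx'⟩ := exists_isClopen_of_totally_separated hne
  obtain ⟨n, hn⟩ := he ⟨U, hU⟩
  have := h n
  simp only [hn] at this
  exact hx' (this.1 hx)

/-- **Back-and-forth.** `P q ρ` says that `q : M → K` and `ρ : N → K` are a matched pair of
approximations. If every matched pair can be refined to one which decides a given clopen subset of
`M`, and to one which decides a given clopen subset of `N`, then each matched pair extends to a
homeomorphism that matches a whole sequence of pairs, separating the points of `N`. -/
theorem exists_homeomorph_of_backAndForth [CompactSpace M] [CompactSpace N] [T2Space M] [T2Space N]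
    [TotallyDisconnectedSpace M] [TotallyDisconnectedSpace N] [SecondCountableTopology M]
    [SecondCountableTopology N] [T2Space K] (P : (M → K) → (N → K) → Prop)
    (hP : ∀ q ρ, P q ρ → Continuous q ∧ Continuous ρ ∧ range q = range ρ)
    (forth : ∀ q ρ, P q ρ → ∀ s : Set M, IsClopen s → ∃ q' ρ', P q' ρ' ∧
      (∀ x y, q' x = ρ' y → q x = ρ y) ∧ ∀ x x', q' x = q' x' → (x ∈ s ↔ x' ∈ s))
    (back : ∀ q ρ, P q ρ → ∀ s : Set N, IsClopen s → ∃ q' ρ', P q' ρ' ∧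
      (∀ x y, q' x = ρ' y → q x = ρ y) ∧ ∀ y y', ρ' y = ρ' y' → (y ∈ s ↔ y' ∈ s))
    (q₀ : M → K) (ρ₀ : N → K) (h₀ : P q₀ ρ₀) :
    ∃ (f : M ≃ₜ N) (q : ℕ → M → K) (ρ : ℕ → N → K), q 0 = q₀ ∧ ρ 0 = ρ₀ ∧
      (∀ n, P (q n) (ρ n)) ∧ (∀ n x, ρ n (f x) = q n x) ∧
      ∀ y y', (∀ n, ρ n y = ρ n y') → y = y' := by
  obtain ⟨s, hs, hs'⟩ := exists_clopen_sequence M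
  obtain ⟨t, ht, ht'⟩ := exists_clopen_sequence N
  have step : ∀ (n : ℕ) (p : {p : (M → K) × (N → K) // P p.1 p.2}),
      ∃ p' : {p : (M → K) × (N → K) // P p.1 p.2},
        (∀ x y, p'.1.1 x = p'.1.2 y → p.1.1 x = p.1.2 y) ∧
        (∀ x x', p'.1.1 x = p'.1.1 x' → (x ∈ s n ↔ x' ∈ s n)) ∧
        ∀ y y', p'.1.2 y = p'.1.2 y' → (y ∈ t n ↔ y' ∈ t n) := by
    rintro n ⟨⟨q, ρ⟩, hp⟩
    obtain ⟨q1, ρ1, h1, h1r, h1s⟩ := forth q ρ hp (s n) (hs n)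
    obtain ⟨q2, ρ2, h2, h2r, h2s⟩ := back q1 ρ1 h1 (t n) (ht n)
    refine ⟨⟨(q2, ρ2), h2⟩, fun x y h => h1r x y (h2r x y h), fun x x' h => h1s x x' ?_, h2s⟩
    obtain ⟨y, hy⟩ : q2 x ∈ range ρ2 := (hP _ _ h2).2.2 ▸ mem_range_self x
    rw [h2r x y hy.symm, h2r x' y (Eq.trans (Eq.symm h) hy.symm)]
  choose F hF using step
  let S : ℕ → {p : (M → K) × (N → K) // P p.1 p.2} := fun n =>
    Nat.rec ⟨(q₀, ρ₀), h₀⟩ (fun n p => F n p) n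
  have hS : ∀ n, S (n + 1) = F n (S n) := fun n => rfl
  have hN : ∀ y y', (∀ n, (S n).1.2 y = (S n).1.2 y') → y = y' := fun y y' h =>
    ht' _ _ fun n => by
      have := (hF n (S n)).2.2 y y'
      rw [← hS] at this
      exact this (h (n + 1))
  have hM : ∀ y y', (∀ n, (S n).1.1 y = (S n).1.1 y') → y = y' := fun y y' h =>
    hs' _ _ fun n => by
      have := (hF n (S n)).2.1 y y'
      rw [← hS] at this
      exact this (h (n + 1))
  obtain ⟨f, hf⟩ := exists_homeomorph_of_sequence (fun n => (S n).1.1) (fun n => (S n).1.2)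
    (fun n => (hP _ _ (S n).2).1) (fun n => (hP _ _ (S n).2).2.1) (fun n => (hP _ _ (S n).2).2.2)
    (fun n x y h => by
      have := (hF n (S n)).1 x y
      rw [← hS] at this
      exact this h) hM hN
  exact ⟨f, fun n => (S n).1.1, fun n => (S n).1.2, rfl, rfl, fun n => (S n).2, hf, hN⟩

end BackAndForth

/-! ### Compact zero-dimensional spaces without isolated points -/

section Perfect

variable {M N K : Type*} [TopologicalSpace M] [TopologicalSpace N]

/-- In a space without isolated points, a non-empty clopen set can be cut by a clopen set `D` with
prescribed emptiness of the two parts, as long as not both parts are to be empty. -/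
theorem exists_clopen_split [CompactSpace N] [T2Space N] [TotallyDisconnectedSpace N]
    (hN : ∀ y : N, ¬ IsOpen {y}) {C : Set N} (hC : IsClopen C) (a b : Prop)
    (hab : C.Nonempty ↔ a ∨ b) :
    ∃ D : Set N, IsClopen D ∧ ((C ∩ D).Nonempty ↔ a) ∧ ((C \ D).Nonempty ↔ b) := by
  by_cases ha : a
  · by_cases hb : b
    · obtain ⟨y, hy⟩ := hab.2 (Or.inl ha)
      obtain ⟨z, hz, hzy⟩ : ∃ z ∈ C, z ≠ y := by
        by_contra! h
        exact hN y (by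
          have : C = {y} := Subset.antisymm (fun z hz => h z hz) (by simpa using hy)
          exact this ▸ hC.isOpen)
      obtain ⟨D, hD, hzD, hyD⟩ := exists_isClopen_of_totally_separated hzy
      exact ⟨D, hD, by simp only [ha, iff_true]; exact ⟨z, hz, hzD⟩,
        by simp only [hb, iff_true]; exact ⟨y, hy, hyD⟩⟩
    · refine ⟨univ, isClopen_univ, ?_, ?_⟩
      · simp [ha, hab]
      · simp [hb]
  · refine ⟨∅, isClopen_empty, ?_, ?_⟩
    · simp [ha]
    · simp [hab, ha]

open Classical in
theorem continuous_refine {p : M → ℕ} (hp : Continuous p) {E : ℕ → Set M}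
    (hE : ∀ v, IsClopen (E v)) :
    Continuous fun z => 2 * p z + if z ∈ E (p z) then 1 else 0 := by
  have hl : IsLocallyConstant fun z => 2 * p z + if z ∈ E (p z) then 1 else 0 := by
    refine (IsLocallyConstant.iff_eventually_eq _).2 fun z => ?_
    have h1 : ∀ᶠ z' in 𝓝 z, p z' = p z :=
      hp.continuousAt.eventually ((isOpen_discrete {p z}).mem_nhds rfl)
    have h2 : ∀ᶠ z' in 𝓝 z, (z' ∈ E (p z) ↔ z ∈ E (p z)) := by
      by_cases hz : z ∈ E (p z)
      · filter_upwards [(hE (p z)).isOpen.mem_nhds hz] with z' hz'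
        simp [hz, hz']
      · filter_upwards [(hE (p z)).compl.isOpen.mem_nhds hz] with z' hz'
        simp only [hz, iff_false]
        exact hz'
    filter_upwards [h1, h2] with z' h1 h2
    rw [h1]
    simp only [h2]
  exact hl.continuous

open Classical in
/-- The refinement step for maps to `ℕ`: a clopen set can be decided, keeping the ranges equal. -/
theorem exists_refinement_nat [CompactSpace N] [T2Space N] [TotallyDisconnectedSpace N]
    (hN : ∀ y : N, ¬ IsOpen {y}) {q : M → ℕ} {ρ : N → ℕ} (hq : Continuous q) (hρ : Continuous ρ)
    (hr : range q = range ρ) {s : Set M} (hs : IsClopen s) :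
    ∃ (q' : M → ℕ) (ρ' : N → ℕ), (Continuous q' ∧ Continuous ρ' ∧ range q' = range ρ') ∧
      (∀ x y, q' x = ρ' y → q x = ρ y) ∧ ∀ x x', q' x = q' x' → (x ∈ s ↔ x' ∈ s) := by
  have h : ∀ v : ℕ, ∃ D : Set N, IsClopen D ∧
      ((ρ ⁻¹' {v} ∩ D).Nonempty ↔ (q ⁻¹' {v} ∩ s).Nonempty) ∧
      ((ρ ⁻¹' {v} \ D).Nonempty ↔ (q ⁻¹' {v} \ s).Nonempty) := by
    intro v
    refine exists_clopen_split hN ((isClopen_discrete {v}).preimage hρ) _ _ ?_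
    rw [← union_nonempty, inter_union_sdiff]
    have := congrArg (fun t => v ∈ t) hr
    simp only [mem_range, eq_iff_iff] at this
    exact this.symm
  choose D hD hD1 hD2 using h
  refine ⟨fun x => 2 * q x + if x ∈ s then 1 else 0,
    fun y => 2 * ρ y + if y ∈ D (ρ y) then 1 else 0,
    ⟨continuous_refine hq (E := fun _ => s) fun _ => hs, continuous_refine hρ hD, ?_⟩, ?_, ?_⟩
  · ext n
    constructor
    · rintro ⟨x, rfl⟩
      by_cases hx : x ∈ s
      · obtain ⟨y, hy, hyD⟩ := (hD1 (q x)).2 ⟨x, rfl, hx⟩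
        have hy : ρ y = q x := hy
        exact ⟨y, by simp [hy, hyD, hx]⟩
      · obtain ⟨y, hy, hyD⟩ := (hD2 (q x)).2 ⟨x, rfl, hx⟩
        have hy : ρ y = q x := hy
        exact ⟨y, by simp [hy, hyD, hx]⟩
    · rintro ⟨y, rfl⟩
      by_cases hy : y ∈ D (ρ y)
      · obtain ⟨x, hx, hxs⟩ := (hD1 (ρ y)).1 ⟨y, rfl, hy⟩
        have hx : q x = ρ y := hx
        exact ⟨x, by simp [hx, hxs, hy]⟩
      · obtain ⟨x, hx, hxs⟩ := (hD2 (ρ y)).1 ⟨y, rfl, hy⟩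
        have hx : q x = ρ y := hx
        exact ⟨x, by simp [hx, hxs, hy]⟩
  · intro x y h
    dsimp only at h
    split_ifs at h <;> omega
  · intro x x' h
    dsimp only at h
    split_ifs at h with h1 h2 h2 <;> first | omega | simp [h1, h2]

/-- A form of Brouwer's characterization of the Cantor space: between compact, metrizable,
zero-dimensional spaces without isolated points, any two clopen partitions with the same labels are
matched by a homeomorphism. -/
theorem exists_homeomorph_matching [CompactSpace M] [CompactSpace N] [T2Space M] [T2Space N]
    [TotallyDisconnectedSpace M] [TotallyDisconnectedSpace N] [SecondCountableTopology M]
    [SecondCountableTopology N] [TopologicalSpace K] [DiscreteTopology K] [Countable K]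
    (hM : ∀ x : M, ¬ IsOpen {x}) (hN : ∀ y : N, ¬ IsOpen {y}) {q : M → K} {ρ : N → K}
    (hq : Continuous q) (hρ : Continuous ρ) (hr : range q = range ρ) :
    ∃ f : M ≃ₜ N, ∀ x, ρ (f x) = q x := by
  obtain ⟨e, he⟩ := exists_injective_nat K
  have hce : Continuous e := continuous_of_discreteTopology
  obtain ⟨f, q', ρ', h1, h2, -, h4, -⟩ := exists_homeomorph_of_backAndForth
    (P := fun (q : M → ℕ) (ρ : N → ℕ) => Continuous q ∧ Continuous ρ ∧ range q = range ρ)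
    (fun q ρ h => h) (fun q ρ h s hs => exists_refinement_nat hN h.1 h.2.1 h.2.2 hs)
    (fun q ρ h s hs => by
      obtain ⟨ρ', q', h', hr', hs'⟩ := exists_refinement_nat hM h.2.1 h.1 h.2.2.symm hs
      exact ⟨q', ρ', ⟨h'.2.1, h'.1, h'.2.2.symm⟩, fun x y hxy => (hr' y x hxy.symm).symm, hs'⟩)
    (e ∘ q) (e ∘ ρ) ⟨hce.comp hq, hce.comp hρ, by rw [range_comp, range_comp, hr]⟩
  refine ⟨f, fun x => he ?_⟩
  have := h4 0 x
  rwa [h1, h2] at this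

end Perfect

/-! ### Flows, codings and minimal subflows -/

section Flows

variable {G M N Y K L : Type*} [Group G] [TopologicalSpace M] [TopologicalSpace N]
  [TopologicalSpace Y]

/-- A flow, that is an action of `G` by homeomorphisms presented as a homomorphism to the
homeomorphism group, is minimal if all its orbits are dense. -/
def IsMinimalFlow (α : G →* (M ≃ₜ M)) : Prop := ∀ x, DenseRange fun g => α g x

/-- The coding of a flow by a labelling `q`: the point `x` is sent to the `q`-itinerary of its
orbit, with the convention that makes the coding equivariant for the left shift. The range of the
coding is the subshift associated with the labelling. -/
def code (α : G →* (M ≃ₜ M)) (q : M → K) (x : M) (g : G) : K := q (α g⁻¹ x)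

/-- The flow given by an action by continuous maps. -/
def flowOf (a : G → M → M) (hc : ∀ g, Continuous (a g)) (h1 : ∀ x, a 1 x = x)
    (hmul : ∀ g h x, a (g * h) x = a g (a h x)) : G →* (M ≃ₜ M) where
  toFun g :=
    { toFun := a g
      invFun := a g⁻¹
      left_inv := fun x => by rw [← hmul, inv_mul_cancel, h1]
      right_inv := fun x => by rw [← hmul, mul_inv_cancel, h1]
      continuous_toFun := hc g
      continuous_invFun := hc g⁻¹ }
  map_one' := Homeomorph.ext h1
  map_mul' g h := Homeomorph.ext (hmul g h)

@[simp]
theorem flowOf_apply (a : G → M → M) (hc h1 hmul) (g : G) (x : M) :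
    flowOf a hc h1 hmul g x = a g x := rfl

theorem flow_one (α : G →* (M ≃ₜ M)) (x : M) : α 1 x = x := by
  rw [map_one]
  rfl

theorem flow_mul (α : G →* (M ≃ₜ M)) (g h : G) (x : M) : α (g * h) x = α g (α h x) := by
  rw [map_mul]
  rfl

/-- Transport of a flow along a homeomorphism. -/
def transport (f : M ≃ₜ N) (α : G →* (M ≃ₜ M)) : G →* (N ≃ₜ N) :=
  flowOf (fun g y => f (α g (f.symm y))) (fun g => by fun_prop) (fun y => by simp)
    fun g h y => by simp

@[simp]
theorem transport_apply (f : M ≃ₜ N) (α : G →* (M ≃ₜ M)) (g : G) (y : N) :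
    transport f α g y = f (α g (f.symm y)) := rfl

/-- The restriction of a flow to an invariant set. -/
def restrict (α : G →* (M ≃ₜ M)) (C : Set M) (hC : ∀ g, ∀ x ∈ C, α g x ∈ C) : G →* (C ≃ₜ C) :=
  flowOf (fun g x => ⟨α g x, hC g x x.2⟩)
    (fun g => ((α g).continuous.comp continuous_subtype_val).subtype_mk _)
    (fun x => Subtype.ext (flow_one α x)) fun g h x => Subtype.ext (flow_mul α g h x)

@[simp]
theorem restrict_apply (α : G →* (M ≃ₜ M)) (C : Set M) (hC : ∀ g, ∀ x ∈ C, α g x ∈ C) (g : G)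
    (x : C) : (restrict α C hC g x : M) = α g x := rfl

/-- The product of two flows. -/
def prodFlow (α : G →* (M ≃ₜ M)) (β : G →* (N ≃ₜ N)) : G →* ((M × N) ≃ₜ (M × N)) :=
  flowOf (fun g x => (α g x.1, β g x.2)) (fun g => by fun_prop)
    (fun x => by simp) fun g h x => by simp

theorem code_one (α : G →* (M ≃ₜ M)) (q : M → K) (x : M) : code α q x 1 = q x := by
  simp [code]

theorem code_flow (α : G →* (M ≃ₜ M)) (q : M → K) (g : G) (x : M) (h : G) :
    code α q (α g x) h = code α q x (g⁻¹ * h) := by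
  simp [code]

theorem continuous_code [TopologicalSpace K] (α : G →* (M ≃ₜ M)) {q : M → K} (hq : Continuous q) :
    Continuous (code α q) :=
  continuous_pi fun g => hq.comp (α g⁻¹).continuous

/-- Labellings of a factor pull back to labellings of the extension with the same coding. -/
theorem code_comp (α : G →* (M ≃ₜ M)) (β : G →* (N ≃ₜ N)) {j : M → N}
    (hj : ∀ g x, j (α g x) = β g (j x)) (q : N → K) (x : M) :
    code α (fun x => q (j x)) x = code β q (j x) := by
  funext g
  simp only [code, hj]

theorem range_code_map (α : G →* (M ≃ₜ M)) (q : M → K) (p : K → L) :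
    range (code α fun x => p (q x)) = (fun u g => p (u g)) '' range (code α q) := by
  rw [← range_comp]
  rfl

theorem closure_orbit_invariant (α : G →* (M ≃ₜ M)) (x : M) (g : G) {y : M}
    (hy : y ∈ closure (range fun g => α g x)) : α g y ∈ closure (range fun g => α g x) := by
  refine map_mem_closure (α g).continuous hy ?_
  rintro _ ⟨h, rfl⟩
  exact ⟨g * h, flow_mul α g h x⟩

theorem exists_minimal_subflow [CompactSpace M] [Nonempty M] (α : G →* (M ≃ₜ M)) :
    ∃ C : Set M, IsClosed C ∧ C.Nonempty ∧ ∃ hC : ∀ g, ∀ x ∈ C, α g x ∈ C,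
      IsMinimalFlow (restrict α C hC) := by
  obtain ⟨C, hC⟩ := zorn_superset
    {C : Set M | IsClosed C ∧ C.Nonempty ∧ ∀ g, ∀ x ∈ C, α g x ∈ C} (by
      intro c hc hchain
      rcases c.eq_empty_or_nonempty with rfl | hne
      · exact ⟨univ, ⟨isClosed_univ, univ_nonempty, fun _ _ _ => mem_univ _⟩, by simp⟩
      · refine ⟨⋂₀ c, ⟨isClosed_sInter fun s hs => (hc hs).1, ?_, ?_⟩, fun s hs =>
          sInter_subset_of_mem hs⟩
        · have := hne.to_subtype
          exact IsCompact.nonempty_sInter_of_directed_nonempty_isCompact_isClosed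
            (fun s hs t ht => (hchain.total hs ht).elim
              (fun h => ⟨s, hs, Subset.rfl, h⟩) fun h => ⟨t, ht, h, Subset.rfl⟩)
            (fun s hs => (hc hs).2.1)
            (fun s hs => (hc hs).1.isCompact) (fun s hs => (hc hs).1)
        · intro g x hx s hs
          exact (hc hs).2.2 g x (hx s hs))
  refine ⟨C, hC.prop.1, hC.prop.2.1, hC.prop.2.2, fun x => ?_⟩
  have hsub : C ⊆ closure (range fun g => α g x) := by
    refine hC.le_of_le (y := closure (range fun g => α g (x : M)))
      ⟨isClosed_closure, ⟨α 1 x, subset_closure ⟨1, rfl⟩⟩,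
      fun g y hy => closure_orbit_invariant α x g hy⟩ ?_
    refine closure_minimal ?_ hC.prop.1
    rintro _ ⟨g, rfl⟩
    exact hC.prop.2.2 g x x.2
  intro y
  rw [closure_subtype]
  convert hsub y.2 using 2
  rw [← range_comp]
  rfl

/-- A factor map onto a minimal flow is automatically surjective. -/
theorem surjective_of_equivariant [CompactSpace M] [Nonempty M] [T2Space Y] {α : G →* (M ≃ₜ M)}
    {β : G →* (Y ≃ₜ Y)} (hβ : IsMinimalFlow β) {j : M → Y} (hj : Continuous j)
    (hjα : ∀ g x, j (α g x) = β g (j x)) : Function.Surjective j := by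
  rw [← range_eq_univ, ← (isCompact_range hj).isClosed.closure_eq, ← dense_iff_closure_eq]
  obtain ⟨x⟩ := ‹Nonempty M›
  refine (hβ (j x)).mono ?_
  rintro _ ⟨g, rfl⟩
  exact ⟨α g x, hjα g x⟩

/-- An isolated point would be met by all orbits, making the space discrete and hence finite. -/
theorem IsMinimalFlow.not_isOpen_singleton [CompactSpace M] [Infinite M] {α : G →* (M ≃ₜ M)}
    (hα : IsMinimalFlow α) (x : M) : ¬ IsOpen {x} := by
  intro hx
  have : DiscreteTopology M := by
    refine discreteTopology_iff_isOpen_singleton.2 fun y => ?_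
    obtain ⟨g, hg⟩ := (hα y).exists_mem_open hx (singleton_nonempty x)
    have h := hx.preimage (α g).continuous
    convert h using 1
    ext z
    simp only [mem_singleton_iff, mem_preimage]
    rw [← mem_singleton_iff.1 hg]
    exact (α g).injective.eq_iff.symm
  exact not_finite_iff_infinite.2 ‹Infinite M› finite_of_compact_of_discrete

theorem IsMinimalFlow.infinite_orbit [T1Space M] [Infinite M] {α : G →* (M ≃ₜ M)}
    (hα : IsMinimalFlow α) (x : M) : (range fun g => α g x).Infinite := by
  intro h
  have := hα x
  rw [DenseRange, dense_iff_closure_eq, h.isClosed.closure_eq] at this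
  rw [this] at h
  exact infinite_univ h

theorem IsMinimalFlow.transport {α : G →* (M ≃ₜ M)} (hα : IsMinimalFlow α) (f : M ≃ₜ N) :
    IsMinimalFlow (transport f α) := fun y =>
  f.surjective.denseRange.comp (hα (f.symm y)) f.continuous

end Flows

/-! ### A free zero-dimensional flow -/

section Free

/-- A fixed-point free permutation of a countable set has a `3`-colouring in which no point has the
colour of its image: colour greedily along an enumeration, each point having two neighbours. -/
theorem exists_three_coloring {X : Type*} [Countable X] (f : Equiv.Perm X) (hf : ∀ x, f x ≠ x) :
    ∃ c : X → Fin 3, ∀ x, c (f x) ≠ c x := by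
  classical
  obtain ⟨e, he⟩ := exists_injective_nat X
  have hp : ∀ a b : Fin 3, ∃ c, c ≠ a ∧ c ≠ b := by decide
  choose p hp1 hp2 using hp
  let wf : WellFounded fun x y => e x < e y := (measure e).wf
  let c : X → Fin 3 := wf.fix fun x ih =>
    p (if h : e (f x) < e x then ih (f x) h else 0)
      (if h : e (f.symm x) < e x then ih (f.symm x) h else 0)
  have hc : ∀ x, c x = p (if e (f x) < e x then c (f x) else 0)
      (if e (f.symm x) < e x then c (f.symm x) else 0) := fun x => wf.fix_eq _ x
  refine ⟨c, fun x => ?_⟩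
  rcases lt_or_gt_of_ne fun h => hf x (he h) with h | h
  · rw [hc x, if_pos h]
    exact (hp1 _ _).symm
  · rw [hc (f x), f.symm_apply_apply, if_pos h]
    exact hp2 _ _

variable (G : Type*) [Group G]

/-- The families, indexed by `k : G`, of `3`-colourings of `G` such that for `k ≠ 1` the points `h`
and `h * k` always have different colours. The shift acts freely on this space. -/
def freeColorings : Set (G → G → Fin 3) := {z | ∀ k ≠ 1, ∀ h, z k (h * k) ≠ z k h}

/-- The left shift on `freeColorings G`. -/
def freeFlow : G →* (freeColorings G ≃ₜ freeColorings G) :=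
  flowOf (fun g z => ⟨fun k h => z.1 k (g⁻¹ * h), fun k hk h => by
      simpa only [mul_assoc] using z.2 k hk (g⁻¹ * h)⟩)
    (fun g => by
      refine Continuous.subtype_mk (continuous_pi fun k => continuous_pi fun h => ?_) _
      exact (continuous_apply_apply k (g⁻¹ * h)).comp continuous_subtype_val)
    (fun z => Subtype.ext (by funext k h; simp))
    fun g h z => Subtype.ext (by funext k l; simp [mul_assoc])

instance : CompactSpace (freeColorings G) := by
  refine isCompact_iff_compactSpace.1 (IsClosed.isCompact ?_)
  simp only [freeColorings, ofPred_forall]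
  refine isClosed_iInter fun k => isClosed_iInter fun _ => isClosed_iInter fun h => ?_
  exact (isClosed_discrete {p : Fin 3 × Fin 3 | p.1 ≠ p.2}).preimage
    (((continuous_apply (h * k)).comp (continuous_apply k)).prodMk
      ((continuous_apply h).comp (continuous_apply k)) :
        Continuous fun z : G → G → Fin 3 => (z k (h * k), z k h))

instance [Countable G] : Nonempty (freeColorings G) := by
  have : ∀ k : G, ∃ c : G → Fin 3, k ≠ 1 → ∀ h, c (h * k) ≠ c h := by
    intro k
    by_cases hk : k = 1
    · exact ⟨fun _ => 0, fun h => absurd hk h⟩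
    · obtain ⟨c, hc⟩ := exists_three_coloring (Equiv.mulRight k) (fun x => by simpa using hk)
      exact ⟨c, fun _ => hc⟩
  choose z hz using this
  exact ⟨z, hz⟩

theorem freeFlow_injective (z : freeColorings G) : Function.Injective fun g => freeFlow G g z := by
  intro g h hgh
  by_contra hne
  refine z.2 (g⁻¹ * h) (fun h1 => hne (inv_mul_eq_one.1 h1)) 1 ?_
  have := congrFun (congrFun (congrArg Subtype.val hgh) (g⁻¹ * h)) h
  simpa [freeFlow] using this

end Free

/-! ### Realizing minimal flows on the Cantor space -/

section Realization

variable {G M N Y K L : Type*} [Group G] [TopologicalSpace M] [TopologicalSpace N]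
  [TopologicalSpace Y] [CompactSpace M] [T2Space M] [TotallyDisconnectedSpace M]
  [SecondCountableTopology M] [Nonempty M] [T2Space Y]
  [TopologicalSpace K] [DiscreteTopology K] [Countable K]

theorem cantor_not_isOpen_singleton (x : Cantor) : ¬ IsOpen {x} := by
  intro h
  obtain ⟨n, hn⟩ : ∃ n, ∀ y : Cantor, (∀ i < n, y i = x i) → y = x := by
    obtain ⟨I, u, hu, hs⟩ := isOpen_pi_iff.1 h x rfl
    obtain ⟨n, hn⟩ := I.exists_nat_subset_range
    exact ⟨n, fun y hy => hs fun i hi => by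
      rw [hy i (Finset.mem_range.1 (hn hi))]; exact (hu i hi).2⟩
  have := congrFun (hn (Function.update x n (!(x n))) fun i hi =>
    Function.update_of_ne hi.ne _ _) n
  simp at this

/-- Let `φ : M → Y` be an equivariant map from a compact metrizable zero-dimensional flow without
finite orbits to a minimal flow, and let `r` be a labelling of `Y`. Then a minimal subflow of `M`
can be moved to the Cantor space, in such a way that the pullback of `r` becomes any prescribed
labelling `ρ` with the same set of labels. The map `j` is the resulting copy of the Cantor space
in `M`. -/
theorem exists_cantor_realization {α : G →* (M ≃ₜ M)}
    (hinf : ∀ x, (range fun g => α g x).Infinite) {β : G →* (Y ≃ₜ Y)} (hβ : IsMinimalFlow β)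
    {φ : M → Y} (hφ : Continuous φ) (hφα : ∀ g x, φ (α g x) = β g (φ x)) {r : Y → K}
    (hr : Continuous r) {ρ : Cantor → K} (hρ : Continuous ρ) (hrange : range r = range ρ) :
    ∃ η : G →* (Cantor ≃ₜ Cantor), IsMinimalFlow η ∧ ∃ j : Cantor → M, Continuous j ∧
      (∀ g ω, j (η g ω) = α g (j ω)) ∧ ∀ ω, r (φ (j ω)) = ρ ω := by
  obtain ⟨C, hCc, hCn, hC, hmin⟩ := exists_minimal_subflow α
  -- An infinite minimal flow has no isolated points, so `C` is a Cantor space.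
  have := isCompact_iff_compactSpace.1 hCc.isCompact
  have := hCn.to_subtype
  have : Infinite C := by
    obtain ⟨x, hx⟩ := hCn
    refine ((hinf x).mono ?_).to_subtype
    rintro _ ⟨g, rfl⟩
    exact hC g x hx
  have hsurj : Function.Surjective fun x : C => φ x :=
    surjective_of_equivariant hβ (hφ.comp continuous_subtype_val)
      (α := restrict α C hC) fun g x => hφα g x
  obtain ⟨f, hf⟩ := exists_homeomorph_matching (q := fun x : C => r (φ x))
    hmin.not_isOpen_singleton cantor_not_isOpen_singleton
    (hr.comp (hφ.comp continuous_subtype_val)) hρ (by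
      rw [← hrange]
      exact hsurj.range_comp r)
  refine ⟨transport f (restrict α C hC), hmin.transport f, fun ω => f.symm ω,
    continuous_subtype_val.comp f.symm.continuous, fun g ω => by simp, fun ω => ?_⟩
  rw [← hf]
  simp

/-- Every minimal compact metrizable zero-dimensional flow, finite or not, has a minimal extension
on the Cantor space, and the pullback of a labelling can be prescribed: the product with a free flow
has no finite orbits. -/
theorem exists_cantor_extension [Countable G] [Infinite G] {α : G →* (M ≃ₜ M)}
    (hα : IsMinimalFlow α) {r : M → K} (hr : Continuous r) {ρ : Cantor → K} (hρ : Continuous ρ)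
    (hrange : range r = range ρ) :
    ∃ η : G →* (Cantor ≃ₜ Cantor), IsMinimalFlow η ∧ ∃ j : Cantor → M, Continuous j ∧
      (∀ g ω, j (η g ω) = α g (j ω)) ∧ ∀ ω, r (j ω) = ρ ω := by
  obtain ⟨η, hη, j, hj, hjη, hjr⟩ := exists_cantor_realization (α := prodFlow α (freeFlow G))
    (fun x => infinite_range_of_injective fun g h hgh =>
      freeFlow_injective G x.2 (congrArg Prod.snd hgh))
    hα continuous_fst (fun g x => rfl) hr hρ hrange
  exact ⟨η, hη, fun ω => (j ω).1, continuous_fst.comp hj,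
    fun g ω => congrArg Prod.fst (hjη g ω), hjr⟩

/-- Two minimal actions on the Cantor space with labellings `π₁`, `π₂` that generate the same
subshift have a common minimal extension on the Cantor space over this subshift; moreover the
extension can be taken to look like the first action, as far as the labelling `σ` and the group
elements in `F` are concerned. -/
theorem exists_cantor_joining {η ξ : G →* (Cantor ≃ₜ Cantor)} (hη : IsMinimalFlow η)
    {π₁ π₂ : Cantor → L} [TopologicalSpace L] [T2Space L] (h₁ : Continuous π₁) (h₂ : Continuous π₂)
    (h : range (code η π₁) = range (code ξ π₂)) {σ : Cantor → K} (hσ : Continuous σ)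
    (F : Finset G) :
    ∃ η' : G →* (Cantor ≃ₜ Cantor), IsMinimalFlow η' ∧ ∃ j₁ j₂ : Cantor → Cantor,
      Continuous j₁ ∧ Continuous j₂ ∧ (∀ g ω, j₁ (η' g ω) = η g (j₁ ω)) ∧
      (∀ g ω, j₂ (η' g ω) = ξ g (j₂ ω)) ∧ (∀ ω, code η π₁ (j₁ ω) = code ξ π₂ (j₂ ω)) ∧
      ∀ ω, ∀ g ∈ F, code η σ (j₁ ω) g = code η σ ω g := by
  let R : Set (Cantor × Cantor) := {p | code η π₁ p.1 = code ξ π₂ p.2}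
  have hRc : IsClosed R := isClosed_eq ((continuous_code η h₁).comp continuous_fst)
    ((continuous_code ξ h₂).comp continuous_snd)
  have hR : ∀ g, ∀ p ∈ R, prodFlow η ξ g p ∈ R := by
    intro g p hp
    have hp : code η π₁ p.1 = code ξ π₂ p.2 := hp
    show code η π₁ (η g p.1) = code ξ π₂ (ξ g p.2)
    funext h
    rw [code_flow, code_flow, hp]
  have := isCompact_iff_compactSpace.1 hRc.isCompact
  have : Nonempty R := by
    obtain ⟨y, hy⟩ : code η π₁ default ∈ range (code ξ π₂) := h ▸ mem_range_self _
    exact ⟨⟨(default, y), hy.symm⟩⟩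
  have hr : Continuous fun ω (g : F) => code η σ ω g :=
    continuous_pi fun g => (continuous_apply g.1).comp (continuous_code η hσ)
  obtain ⟨η', hη', j, hj, hjη, hjr⟩ := exists_cantor_realization
    (α := restrict (prodFlow η ξ) R hR) (φ := fun p => p.1.1) (β := η)
    (r := fun ω (g : F) => code η σ ω g) (ρ := fun ω (g : F) => code η σ ω g)
    (fun x hx => hη.infinite_orbit x.1.1 ((hx.image fun p => p.1.1).subset (by
      rintro _ ⟨g, rfl⟩
      exact ⟨_, ⟨g, rfl⟩, rfl⟩)))
    hη (continuous_fst.comp continuous_subtype_val) (fun g x => rfl) hr hr rfl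
  refine ⟨η', hη', fun ω => (j ω).1.1, fun ω => (j ω).1.2,
    continuous_fst.comp (continuous_subtype_val.comp hj),
    continuous_snd.comp (continuous_subtype_val.comp hj),
    fun g ω => congrArg (fun p => p.1.1) (hjη g ω), fun g ω => congrArg (fun p => p.1.2) (hjη g ω),
    fun ω => (j ω).2, fun ω g hg => congrFun (hjr ω) ⟨g, hg⟩⟩

end Realization

/-! ### The space of minimal actions -/

section Space

variable {K L : Type*} [TopologicalSpace K] [DiscreteTopology K]

/-- A Lebesgue number lemma for products of discrete spaces. -/
theorem exists_finset_agree {ι : Type*} {C U : Set (ι → K)} (hC : IsCompact C) (hU : IsOpen U)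
    (hCU : C ⊆ U) : ∃ F : Finset ι, ∀ x ∈ C, ∀ y : ι → K, (∀ i ∈ F, y i = x i) → y ∈ U := by
  classical
  have h : ∀ x : ι → K, ∃ I : Finset ι, x ∈ C → ∀ y : ι → K, (∀ i ∈ I, y i = x i) → y ∈ U := by
    intro x
    by_cases hx : x ∈ C
    · obtain ⟨I, u, hu, hs⟩ := isOpen_pi_iff.1 hU x (hCU hx)
      exact ⟨I, fun _ y hy => hs fun i hi => by rw [hy i hi]; exact (hu i hi).2⟩
    · exact ⟨∅, fun h => absurd h hx⟩
  choose I hI using h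
  obtain ⟨t, ht, hCt⟩ := hC.elim_nhds_subcover (fun x => {y | ∀ i ∈ I x, y i = x i})
    fun x _ => by
      have : IsOpen {y : ι → K | ∀ i ∈ I x, y i = x i} := by
        have := isOpen_set_pi (I x).finite_toSet
          fun i _ => isOpen_discrete ({x i} : Set K)
        exact this
      exact this.mem_nhds fun i _ => rfl
  refine ⟨t.biUnion I, fun x hx y hy => ?_⟩
  obtain ⟨z, hz, hxz⟩ := mem_iUnion₂.1 (hCt hx)
  exact hI z (ht z hz) y fun i hi =>
    (hy i (Finset.mem_biUnion.2 ⟨z, hz, hi⟩)).trans (hxz i hi)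

/-- On a compact space, labellings are isolated points in the compact-open topology. -/
theorem isOpen_singleton_continuousMap {X : Type*} [TopologicalSpace X] [CompactSpace X]
    (h : C(X, K)) : IsOpen {h} := by
  have hfin : (range h).Finite := (isCompact_range h.continuous).finite_of_discrete
  have : ({h} : Set C(X, K)) = ⋂ k ∈ range h, {f : C(X, K) | MapsTo f (h ⁻¹' {k}) {k}} := by
    ext f
    simp only [mem_singleton_iff, mem_iInter]
    constructor
    · rintro rfl k - x hx
      exact hx
    · intro hf
      ext x
      exact hf (h x) ⟨x, rfl⟩ rfl
  rw [this]
  exact hfin.isOpen_biInter fun k _ => ContinuousMap.isOpen_setOfPred_mapsTo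
    ((isClosed_discrete {k}).preimage h.continuous).isCompact (isOpen_discrete {k})

instance {X : Type*} [TopologicalSpace X] [CompactSpace X] : DiscreteTopology C(X, K) :=
  discreteTopology_iff_isOpen_singleton.2 isOpen_singleton_continuousMap

instance [Countable K] : Countable C(Cantor, K) :=
  separableSpace_iff_countable.1 inferInstance

end Space

section XiSpace

variable {G K : Type*} [Group G] [TopologicalSpace K] [DiscreteTopology K]

/-- The set of actions for which the `σ`-itineraries of all points agree, on `F`, with those for
the action `ξ`. These sets, for clopen labellings `σ`, form a neighbourhood basis at `ξ`. -/
def nearby (ξ : G →* (Cantor ≃ₜ Cantor)) (σ : Cantor → K) (F : Finset G) : Set (Xi G) :=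
  {η | ∀ ω, ∀ g ∈ F, code η σ ω g = code ξ σ ω g}

theorem mem_xiMin_iff {ξ : Xi G} : ξ ∈ XiMin G ↔ IsMinimalFlow (G := G) ξ :=
  ⟨fun h => (@MulAction.IsMinimal.dense_orbit G Cantor _ _ (Xi.toMulAction ξ) h),
    fun h => @MulAction.IsMinimal.mk G Cantor _ _ (Xi.toMulAction ξ) h⟩

/-- The embedding of the space of actions in a power of the space of continuous self-maps. -/
def toMaps (ξ : Xi G) (g : G) : C(Cantor, Cantor) := ((show G →* (Cantor ≃ₜ Cantor) from ξ) g)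

theorem isInducing_toMaps : IsInducing (toMaps (G := G)) :=
  (IsInducing.piMap fun _ : G =>
    (⟨rfl⟩ : IsInducing fun f : Cantor ≃ₜ Cantor => (f : C(Cantor, Cantor)))).comp ⟨rfl⟩

theorem isOpen_nearby (ξ : G →* (Cantor ≃ₜ Cantor)) {σ : Cantor → K} (hσ : Continuous σ)
    (F : Finset G) : IsOpen (nearby ξ σ F) := by
  have : nearby ξ σ F = ⋂ g ∈ F, (fun η : Xi G =>
      (ContinuousMap.mk σ hσ).comp (toMaps η g⁻¹)) ⁻¹'
        {(ContinuousMap.mk σ hσ).comp (toMaps (G := G) ξ g⁻¹)} := by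
    ext η
    simp only [nearby, mem_ofPred_eq, mem_iInter, mem_preimage, mem_singleton_iff,
      ContinuousMap.ext_iff]
    exact ⟨fun h g hg ω => h ω g hg, fun h ω g hg => h g hg ω⟩
  rw [this]
  refine F.finite_toSet.isOpen_biInter fun g _ => (isOpen_discrete _).preimage ?_
  exact (ContinuousMap.continuous_postcomp _).comp
    ((continuous_apply g⁻¹).comp isInducing_toMaps.continuous)

theorem nearby_mem_nhds {ξ : Xi G} {σ : Cantor → K} (hσ : Continuous σ)
    (F : Finset G) : nearby (G := G) ξ σ F ∈ 𝓝 ξ :=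
  (isOpen_nearby (G := G) ξ hσ F).mem_nhds fun _ _ _ => rfl

/-- Each neighbourhood of an action contains one given by constraining
finitely many coordinates of finitely many of the maps. -/
theorem exists_coordinates {ξ : Xi G} {U : Set (Xi G)} (hU : U ∈ 𝓝 ξ) :
    ∃ (F : Finset G) (I : Finset ℕ), ∀ η : Xi G,
      (∀ g ∈ F, ∀ ω, ∀ i ∈ I, toMaps η g ω i = toMaps ξ g ω i) → η ∈ U := by
  classical
  -- The filter of sets with this property is compared with the neighbourhood filter by testing
  -- convergence of the single maps in the compact-open topology.
  let B : Filter (Xi G) :=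
    { sets := {U | ∃ (F : Finset G) (I : Finset ℕ), ∀ η : Xi G,
        (∀ g ∈ F, ∀ ω, ∀ i ∈ I, toMaps η g ω i = toMaps ξ g ω i) → η ∈ U}
      univ_sets := ⟨∅, ∅, fun _ _ => mem_univ _⟩
      sets_of_superset := fun ⟨F, I, h⟩ hUV => ⟨F, I, fun η hη => hUV (h η hη)⟩
      inter_sets := fun ⟨F, I, h⟩ ⟨F', I', h'⟩ => ⟨F ∪ F', I ∪ I', fun η hη =>
        ⟨h η fun g hg ω i hi => hη g (Finset.mem_union_left _ hg) ω i (Finset.mem_union_left _ hi),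
        h' η fun g hg ω i hi =>
          hη g (Finset.mem_union_right _ hg) ω i (Finset.mem_union_right _ hi)⟩⟩ }
  suffices h : B ≤ 𝓝 ξ from h hU
  rw [isInducing_toMaps.nhds_eq_comap, ← map_le_iff_le_comap]
  refine tendsto_pi_nhds.2 fun g => ContinuousMap.tendsto_nhds_compactOpen.2 fun C hC V hV hCV => ?_
  obtain ⟨I, hI⟩ := exists_finset_agree (hC.image (toMaps ξ g).continuous) hV hCV.image_subset
  exact ⟨{g}, I, fun η hη ω hω => hI _ (mem_image_of_mem _ hω) _ fun i hi =>
    hη g (Finset.mem_singleton_self g) ω i hi⟩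

/-- The sets `nearby ξ σ F` form a neighbourhood basis at `ξ`; `σ` can be taken to refine a given
labelling `π`, and to have values in `ℕ`. -/
theorem exists_nearby_subset {ξ : Xi G} {U : Set (Xi G)} (hU : U ∈ 𝓝 ξ) [Countable K]
    {π : Cantor → K} (hπ : Continuous π) :
    ∃ (σ : Cantor → ℕ) (F : Finset G), Continuous σ ∧ 1 ∈ F ∧
      (∀ ω ω', σ ω = σ ω' → π ω = π ω') ∧ nearby (G := G) ξ σ F ⊆ U := by
  classical
  obtain ⟨F, I, h⟩ := exists_coordinates hU
  obtain ⟨e, he⟩ := exists_injective_nat ((I → Bool) × K)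
  have hs : Continuous fun ω : Cantor => ((fun i : I => ω i, π ω) : (I → Bool) × K) :=
    (continuous_pi fun i => continuous_apply _).prodMk hπ
  refine ⟨fun ω => e (fun i : I => ω i, π ω), insert 1 (F.image fun g => g⁻¹),
    (continuous_of_discreteTopology (f := e)).comp hs, Finset.mem_insert_self _ _,
    fun ω ω' h => congrArg Prod.snd (he h), fun η hη => h η fun g hg ω i hi => ?_⟩
  have h1 := hη ω g⁻¹ (Finset.mem_insert_of_mem (Finset.mem_image_of_mem _ hg))
  have h2 := congrFun (congrArg Prod.fst (he h1)) ⟨i, hi⟩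
  simp only [inv_inv] at h2
  exact h2

/-- The range is closed: a multiplicative family of continuous maps that sends `1` to the identity
consists of homeomorphisms. -/
theorem isClosedEmbedding_toMaps : IsClosedEmbedding (toMaps (G := G)) := by
  refine ⟨⟨isInducing_toMaps, fun ξ η h => ?_⟩, ?_⟩
  · refine MonoidHom.ext (M := G) (N := Cantor ≃ₜ Cantor) fun g => Homeomorph.ext fun ω => ?_
    exact DFunLike.congr_fun (congrFun h g) ω
  · have : range (toMaps (G := G)) = {f | f 1 = ContinuousMap.id Cantor} ∩
        ⋂ g, ⋂ h, {f | f (g * h) = (f g).comp (f h)} := by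
      ext f
      simp only [mem_inter_iff, mem_iInter, mem_ofPred_eq]
      constructor
      · rintro ⟨ξ, rfl⟩
        exact ⟨ContinuousMap.ext fun ω => flow_one (G := G) ξ ω,
          fun g h => ContinuousMap.ext fun ω => flow_mul (G := G) ξ g h ω⟩
      · rintro ⟨h1, hmul⟩
        exact ⟨flowOf (fun g => f g) (fun g => (f g).continuous) (fun x => by rw [h1]; rfl)
          fun g h x => by rw [hmul]; rfl, rfl⟩
    rw [this]
    refine (isClosed_eq (continuous_apply 1) continuous_const).inter
      (isClosed_iInter fun g => isClosed_iInter fun h => isClosed_eq (continuous_apply _) ?_)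
    exact (continuous_apply g).compCM (continuous_apply h)

instance [Countable G] : IsCompletelyMetrizableSpace (Xi G) := by
  have : (uniformity Bool).IsCountablyGenerated := by
    rw [DiscreteUniformity.eq_principal_setRelId]
    infer_instance
  exact isClosedEmbedding_toMaps.IsCompletelyMetrizableSpace

/-- By compactness, minimality means that each clopen set has finitely many translates that cover
the space, and for a given clopen set this is an open condition. -/
theorem isGδ_xiMin : IsGδ (XiMin G) := by
  classical
  have hcount : Countable (Clopens Cantor) := Clopens.countable_iff_secondCountable.2 inferInstance
  have : XiMin G = ⋂ U : Clopens Cantor, {ξ : Xi G | (U : Set Cantor).Nonempty →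
      ∃ F : Finset G, ∀ ω, ∃ g ∈ F, toMaps ξ g ω ∈ U} := by
    ext ξ
    rw [mem_xiMin_iff, mem_iInter]
    constructor
    · intro h U hU
      have hcov : (univ : Set Cantor) ⊆ ⋃ g : G, toMaps ξ g ⁻¹' U := fun ω _ => by
        obtain ⟨g, hg⟩ := (h ω).exists_mem_open U.isClopen.isOpen hU
        exact mem_iUnion.2 ⟨g, hg⟩
      obtain ⟨F, hF⟩ := isCompact_univ.elim_finite_subcover _
        (fun g => U.isClopen.isOpen.preimage (toMaps ξ g).continuous) hcov
      exact ⟨F, fun ω => by simpa using hF (mem_univ ω)⟩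
    · intro h ω
      refine dense_iff_inter_open.2 fun V hV ⟨y, hy⟩ => ?_
      obtain ⟨U, hU, hyU, hUV⟩ := compact_exists_isClopen_in_isOpen hV hy
      obtain ⟨F, hF⟩ := h ⟨U, hU⟩ ⟨y, hyU⟩
      obtain ⟨g, -, hg⟩ := hF ω
      exact ⟨_, hUV hg, g, rfl⟩
  rw [this]
  refine .iInter fun U => IsOpen.isGδ ?_
  refine isOpen_iff_mem_nhds.2 fun ξ hξ => ?_
  by_cases hU : (U : Set Cantor).Nonempty
  · obtain ⟨F, hF⟩ := hξ hU
    have hσ : Continuous fun ω : Cantor => decide (ω ∈ U) := by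
      refine continuous_bool_rng true |>.2 ?_
      convert U.isClopen using 1
      ext ω
      simp
    filter_upwards [nearby_mem_nhds (ξ := ξ) hσ (F.image fun g => g⁻¹)] with η hη _
    refine ⟨F, fun ω => ?_⟩
    obtain ⟨g, hg, hgU⟩ := hF ω
    refine ⟨g, hg, ?_⟩
    have := hη ω g⁻¹ (Finset.mem_image_of_mem _ hg)
    simp only [code, inv_inv, decide_eq_decide] at this
    exact this.2 hgU
  · exact Filter.mem_of_superset univ_mem fun η _ h => absurd h hU

/-- A Gδ subset of a completely metrizable space is a Baire space. -/
theorem baireSpace_of_isGδ {X : Type*} [TopologicalSpace X] [IsCompletelyMetrizableSpace X]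
    {s : Set X} (hs : IsGδ s) : BaireSpace s := by
  have : IsCompletelyMetrizableSpace (closure s) :=
    isClosed_closure.isClosedEmbedding_subtypeVal.IsCompletelyMetrizableSpace
  have : BaireSpace ((↑) ⁻¹' s : Set (closure s)) :=
    (hs.preimage continuous_subtype_val).baireSpace_of_dense
    (by simp [Subtype.dense_iff, inter_eq_right.mpr subset_closure])
  have h : Homeomorph ((↑) ⁻¹' s : Set (closure s)) s := ⟨⟨fun x => ⟨x, x.2⟩,
    fun x => ⟨⟨x, subset_closure x.2⟩, x.2⟩, by grind, by grind⟩, by fun_prop, by fun_prop⟩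
  exact h.baireSpace

instance [Countable G] : BaireSpace (XiMin G) := baireSpace_of_isGδ isGδ_xiMin

theorem nonempty_xiMin [Countable G] [Infinite G] : Nonempty (XiMin G) := by
  obtain ⟨η, hη, -⟩ := exists_cantor_extension (G := G) (M := Unit) (α := 1)
    (fun _ => Function.Surjective.denseRange fun _ => ⟨1, rfl⟩) (r := id) continuous_id
    (ρ := fun _ => ()) continuous_const (by ext; simp)
  exact ⟨⟨η, mem_xiMin_iff.2 hη⟩⟩

end XiSpace

/-! ### Minimal subshifts and the Vietoris topology -/

section Shift

variable {G A B : Type*} [Group G]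

instance [Finite A] : CompactSpace (FullShift G A) :=
  letI : TopologicalSpace A := ⊥
  inferInstanceAs (CompactSpace (G → A))

instance : T2Space (FullShift G A) :=
  letI : TopologicalSpace A := ⊥
  haveI : DiscreteTopology A := ⟨rfl⟩
  inferInstanceAs (T2Space (G → A))

instance : TotallyDisconnectedSpace (FullShift G A) :=
  letI : TopologicalSpace A := ⊥
  haveI : DiscreteTopology A := ⟨rfl⟩
  inferInstanceAs (TotallyDisconnectedSpace (G → A))

instance [Countable G] [Finite A] : SecondCountableTopology (FullShift G A) :=
  letI : TopologicalSpace A := ⊥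
  haveI : DiscreteTopology A := ⟨rfl⟩
  inferInstanceAs (SecondCountableTopology (G → A))

theorem shift_apply (g : G) (x : FullShift G A) (h : G) : (g • x) h = x (g⁻¹ * h) := rfl

theorem continuous_shift (g : G) : Continuous fun x : FullShift G A => g • x :=
  letI : TopologicalSpace A := ⊥
  continuous_pi (A := fun _ : G => A) fun h => continuous_apply (A := fun _ : G => A) (g⁻¹ * h)

variable (G A) in
/-- The shift as a flow. -/
def shiftFlow : G →* (FullShift G A ≃ₜ FullShift G A) :=
  flowOf (fun g x => g • x) continuous_shift (one_smul G) mul_smul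

/-- The coding map `code`, with values in the type synonym carrying the shift action. -/
abbrev codeShift {M : Type*} [TopologicalSpace M] (α : G →* (M ≃ₜ M)) (q : M → A) (x : M) :
    FullShift G A := code α q x

theorem shift_code {M : Type*} [TopologicalSpace M] (α : G →* (M ≃ₜ M)) (q : M → A) (g : G)
    (x : M) : g • codeShift α q x = codeShift α q (α g x) :=
  funext fun h => (code_flow α q g x h).symm

/-- The underlying set of a minimal subshift. -/
abbrev points (X : SMin G (FullShift G A)) : Set (FullShift G A) := (X.1.1 : Set _)

/-- A minimal subshift as a flow. -/
def subshiftFlow (X : SMin G (FullShift G A)) : G →* ((points X) ≃ₜ (points X)) :=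
  restrict (shiftFlow G A) (points X) X.1.2

theorem isMinimalFlow_subshiftFlow (X : SMin G (FullShift G A)) : IsMinimalFlow (subshiftFlow X) :=
  X.2.dense_orbit

section OfCode

variable {M : Type*} [TopologicalSpace M]

theorem continuous_code_fullShift (α : G →* (M ≃ₜ M)) {q : M → A} (hq : IsLocallyConstant q) :
    Continuous fun x => codeShift α q x :=
  letI : TopologicalSpace A := ⊥
  continuous_code α hq.continuous

/-- The subshift generated by a labelling of a flow. -/
def subflowOfCode [CompactSpace M] [Nonempty M] (α : G →* (M ≃ₜ M)) (q : M → A)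
    (hq : IsLocallyConstant q) : Subflow G (FullShift G A) :=
  ⟨⟨⟨range (codeShift α q), isCompact_range (continuous_code_fullShift α hq)⟩, range_nonempty _⟩,
    by
      rintro g _ ⟨x, rfl⟩
      exact ⟨α g x, (shift_code α q g x).symm⟩⟩

theorem subflowOfCode_mem [CompactSpace M] [Nonempty M] {α : G →* (M ≃ₜ M)} (hα : IsMinimalFlow α)
    {q : M → A} (hq : IsLocallyConstant q) :
    subflowOfCode α q hq ∈ SMin G (FullShift G A) := by
  refine ⟨?_⟩
  rintro ⟨_, x, rfl⟩ ⟨_, y, rfl⟩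
  rw [closure_subtype]
  have h := map_mem_closure (continuous_code_fullShift α hq) (hα x y)
    (t := Subtype.val '' MulAction.orbit G
      (⟨codeShift α q x, ⟨x, rfl⟩⟩ : (subflowOfCode α q hq).1)) ?_
  · exact h
  · rintro _ ⟨g, rfl⟩
    exact ⟨_, ⟨g, rfl⟩, shift_code α q g x⟩

/-- The minimal subshift generated by a labelling of a minimal flow. -/
def subshiftOfCode [CompactSpace M] [Nonempty M] (α : G →* (M ≃ₜ M)) (hα : IsMinimalFlow α)
    (q : M → A) (hq : IsLocallyConstant q) : SMin G (FullShift G A) :=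
  ⟨subflowOfCode α q hq, subflowOfCode_mem hα hq⟩

@[simp]
theorem points_ofCode [CompactSpace M] [Nonempty M] (α : G →* (M ≃ₜ M))
    (hα : IsMinimalFlow α) (q : M → A) (hq : IsLocallyConstant q) :
    points (subshiftOfCode α hα q hq) = range (codeShift α q) := rfl

end OfCode

theorem continuous_eval {G A : Type*} [t : TopologicalSpace A] [DiscreteTopology A] (g : G) :
    Continuous fun x : FullShift G A => x g := by
  obtain rfl : t = ⊥ := DiscreteTopology.eq_bot
  exact @continuous_apply G (fun _ => A) (fun _ => ⊥) g

/-- The set of patterns on `F` of a set of configurations. -/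
def patterns (F : Finset G) (S : Set (G → A)) : Set (F → A) := (fun u (g : F) => u g) '' S

theorem exists_agree_of_patterns_subset {G A : Type*} {F : Finset G} {S T : Set (G → A)}
    (h : patterns F S ⊆ patterns F T) {x : G → A} (hx : x ∈ S) :
    ∃ y ∈ T, ∀ g ∈ F, x g = y g := by
  obtain ⟨y, hy, hxy⟩ := h ⟨x, hx, rfl⟩
  exact ⟨y, hy, fun g hg => (congrFun hxy ⟨g, hg⟩).symm⟩

theorem isInducing_points : IsInducing (fun X : SMin G (FullShift G A) => X.1.1) :=
  IsInducing.subtypeVal.comp IsInducing.subtypeVal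

theorem isOpen_patterns_eq [Finite A] (F : Finset G) (P : Set (F → A)) :
    IsOpen {Y : SMin G (FullShift G A) | patterns F (points Y) = P} := by
  let _ : TopologicalSpace A := ⊥
  have : DiscreteTopology A := ⟨rfl⟩
  have hc : Continuous fun (u : FullShift G A) (g : F) => u g :=
    continuous_pi fun g => continuous_apply (A := fun _ : G => A) g.1
  have : {Y : SMin G (FullShift G A) | patterns F (points Y) = P} =
      (fun Y => Y.1.1) ⁻¹' ({K : NonemptyCompacts (FullShift G A) |
          (K : Set (FullShift G A)) ⊆ (fun u (g : F) => u g) ⁻¹' P} ∩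
        ⋂ p ∈ P, {K : NonemptyCompacts (FullShift G A) |
          ((K : Set (FullShift G A)) ∩ (fun u (g : F) => u g) ⁻¹' {p}).Nonempty}) := by
    ext Y
    simp only [mem_ofPred_eq, mem_preimage, mem_inter_iff, mem_iInter]
    refine ⟨?_, fun ⟨h1, h2⟩ => ?_⟩
    · rintro rfl
      refine ⟨fun u hu => ⟨u, hu, rfl⟩, ?_⟩
      rintro _ ⟨u, hu, rfl⟩
      exact ⟨u, hu, rfl⟩
    · refine Subset.antisymm (image_subset_iff.2 h1) fun p hp => ?_
      obtain ⟨u, hu, hup⟩ := h2 p hp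
      exact ⟨u, hu, hup⟩
  rw [this]
  refine IsOpen.preimage isInducing_points.continuous (IsOpen.inter ?_ ?_)
  · exact NonemptyCompacts.isOpen_subsets_of_isOpen ((isOpen_discrete P).preimage hc)
  · exact P.toFinite.isOpen_biInter fun p _ =>
      NonemptyCompacts.isOpen_inter_nonempty_of_isOpen ((isOpen_discrete {p}).preimage hc)

/-- Having the same patterns on a finite set is a basic Vietoris neighbourhood. -/
theorem exists_patterns_subset {X : SMin G (FullShift G A)} {U : Set (SMin G (FullShift G A))}
    (hU : U ∈ 𝓝 X) : ∃ F : Finset G, ∀ Y : SMin G (FullShift G A),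
      patterns F (points Y) = patterns F (points X) → Y ∈ U := by
  classical
  let _ : TopologicalSpace A := ⊥
  have : DiscreteTopology A := ⟨rfl⟩
  let _ : TopologicalSpace (Set (FullShift G A)) := TopologicalSpace.vietoris _
  have hind := NonemptyCompacts.isEmbedding_coe.isInducing.comp
    (isInducing_points (G := G) (A := A))
  rw [hind.nhds_eq_comap, mem_comap] at hU
  obtain ⟨V, hV, hVU⟩ := hU
  obtain ⟨_, ⟨u, ⟨hu, huo⟩, rfl⟩, ⟨hX1, hX2⟩, huV⟩ := vietoris.isTopologicalBasis.mem_nhds_iff.1 hV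
  obtain ⟨F₀, hF₀⟩ := exists_finset_agree (ι := G) (K := A) X.1.1.isCompact (isOpen_sUnion huo) hX1
  have h : ∀ W : Set (FullShift G A), ∃ F : Finset G, W ∈ u → ∃ x ∈ (points X),
      ∀ y : FullShift G A, (∀ i ∈ F, y i = x i) → y ∈ W := by
    intro W
    by_cases hW : W ∈ u
    · obtain ⟨x, hxX, hxW⟩ := hX2 W hW
      obtain ⟨F, hF⟩ := exists_finset_agree (ι := G) (K := A) (C := {x}) isCompact_singleton
        (huo W hW) (singleton_subset_iff.2 hxW)
      exact ⟨F, fun _ => ⟨x, hxX, hF x rfl⟩⟩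
    · exact ⟨∅, fun h => absurd h hW⟩
  choose F hF using h
  refine ⟨F₀ ∪ hu.toFinset.biUnion F, fun Y hY => hVU (huV ⟨fun y hy => ?_, fun W hW => ?_⟩)⟩
  · obtain ⟨x, hx, hxy⟩ := exists_agree_of_patterns_subset hY.subset hy
    exact hF₀ x hx y fun i hi => hxy i (Finset.mem_union_left _ hi)
  · obtain ⟨x, hx, hxW⟩ := hF W hW
    obtain ⟨y, hy, hxy⟩ := exists_agree_of_patterns_subset hY.superset hx
    exact ⟨y, hy, hxW y fun i hi => (hxy i (Finset.mem_union_right _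
      (Finset.mem_biUnion.2 ⟨W, hu.mem_toFinset.2 hW, hi⟩))).symm⟩

/-- Every minimal subshift `Y` is generated by a labelling `τ` of a minimal action on the Cantor
space. Moreover, given locally constant data `r` on `Y`, the action can be arranged so as to make
`r` take prescribed values. -/
theorem exists_cantor_code {K : Type*} [TopologicalSpace K] [DiscreteTopology K] [Countable K]
    [Countable G] [Infinite G] [Finite B] (Y : SMin G (FullShift G B)) {r : FullShift G B → K}
    (hr : Continuous r) {ρ : Cantor → K} (hρ : Continuous ρ) (h : r '' (points Y) = range ρ) :
    ∃ η : G →* (Cantor ≃ₜ Cantor), IsMinimalFlow η ∧ ∃ τ : Cantor → B, IsLocallyConstant τ ∧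
      range (codeShift η τ) = points Y ∧ ∀ ω, r (codeShift η τ ω) = ρ ω := by
  let _ : TopologicalSpace B := ⊥
  have : DiscreteTopology B := ⟨rfl⟩
  have : CompactSpace (points Y) := isCompact_iff_compactSpace.1 Y.1.1.isCompact
  have : Nonempty (points Y) := Y.1.1.nonempty.to_subtype
  obtain ⟨η, hη, j, hj, hjη, hjr⟩ := exists_cantor_extension (isMinimalFlow_subshiftFlow Y)
    (r := fun y => r y) (hr.comp continuous_subtype_val) hρ (by
      rw [← h, image_eq_range])
  have hj' : Continuous fun ω => ((j ω : points Y) : FullShift G B) :=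
    continuous_subtype_val.comp hj
  have hτ : Continuous fun ω => ((j ω : points Y) : FullShift G B) 1 := (continuous_eval 1).comp hj'
  have hcode : ∀ ω, codeShift η (fun ω => (j ω).1 1) ω = (j ω).1 := by
    intro ω
    funext g
    rw [codeShift, code, hjη]
    show (j ω).1 (g⁻¹⁻¹ * 1) = (j ω).1 g
    simp
  refine ⟨η, hη, fun ω => (j ω).1 1, IsLocallyConstant.iff_continuous _ |>.2 hτ, ?_,
    fun ω => by rw [hcode]; exact hjr ω⟩
  have hsurj := surjective_of_equivariant (isMinimalFlow_subshiftFlow Y) hj hjη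
  rw [funext hcode]
  ext y
  constructor
  · rintro ⟨ω, rfl⟩
    exact (j ω).2
  · intro hy
    obtain ⟨ω, hω⟩ := hsurj ⟨y, hy⟩
    exact ⟨ω, congrArg Subtype.val hω⟩

/-- A continuous equivariant map between full shifts is a block map. -/
theorem exists_block [Finite A] [Finite B] {Φ : FullShift G B → FullShift G A} (hΦ : Continuous Φ) :
    ∃ E : Finset G, ∀ x y : FullShift G B, (∀ g ∈ E, x g = y g) → Φ x 1 = Φ y 1 := by
  classical
  let _ : TopologicalSpace A := ⊥
  have : DiscreteTopology A := ⟨rfl⟩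
  let _ : TopologicalSpace B := ⊥
  have : DiscreteTopology B := ⟨rfl⟩
  have hc : Continuous fun x => Φ x 1 := (continuous_eval 1).comp hΦ
  have h : ∀ a : A, ∃ F : Finset G, ∀ x : FullShift G B, Φ x 1 = a →
      ∀ y : FullShift G B, (∀ i ∈ F, y i = x i) → Φ y 1 = a := fun a =>
    exists_finset_agree (ι := G) (K := B) ((isClosed_discrete {a}).preimage hc).isCompact
      ((isOpen_discrete {a}).preimage hc) Subset.rfl
  choose F hF using h
  have := Fintype.ofFinite A
  exact ⟨Finset.univ.biUnion F, fun x y hxy => hF _ y rfl x fun i hi =>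
    hxy i (Finset.mem_biUnion.2 ⟨_, Finset.mem_univ _, hi⟩)⟩

/-- An equivariant map `Φ` of full shifts sends codings to codings. -/
theorem map_code {M : Type*} [TopologicalSpace M] (α : G →* (M ≃ₜ M))
    {Φ : FullShift G B → FullShift G A} (hΦ : ∀ (g : G) x, Φ (g • x) = g • Φ x) (τ : M → B)
    (x : M) : codeShift α (fun x => Φ (codeShift α τ x) 1) x = Φ (codeShift α τ x) := by
  funext g
  rw [codeShift, code, ← shift_code, hΦ, shift_apply]
  simp

theorem isFactorMap_letters {p : B → A} (hp : Function.Surjective p) :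
    IsFactorMap G fun (x : FullShift G B) => (show FullShift G A from fun g => p (x g)) where
  continuous := by
    let _ : TopologicalSpace A := ⊥
    let _ : TopologicalSpace B := ⊥
    have : DiscreteTopology B := ⟨rfl⟩
    exact continuous_pi fun g => continuous_of_discreteTopology.comp
      (continuous_apply (A := fun _ : G => B) g)
  equivariant _ _ := rfl
  surjective := hp.comp_left

end Shift

/-! ### Stable labellings -/

section Stable

variable {G K L : Type*} [Group G]

/-- The homomorphism underlying a minimal action. -/
abbrev hom (ξ : XiMin G) : G →* (Cantor ≃ₜ Cantor) := ξ.1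

theorem isMinimalFlow_hom (ξ : XiMin G) : IsMinimalFlow (hom ξ) := mem_xiMin_iff.1 ξ.2

/-- A labelling `π` is stable at a minimal action `ξ` if all minimal actions close to `ξ` generate,
by means of `π`, the same subshift as `ξ`. -/
def Stable (ξ : XiMin G) (π : Cantor → K) : Prop :=
  ∀ᶠ η in 𝓝 ξ, range (code (hom η) π) = range (code (hom ξ) π)

theorem eventually_code_eq [TopologicalSpace K] [DiscreteTopology K] (ξ : XiMin G) {σ : Cantor → K}
    (hσ : Continuous σ) (F : Finset G) :
    ∀ᶠ η in 𝓝 ξ, ∀ ω, ∀ g ∈ F, code (hom η) σ ω g = code (hom ξ) σ ω g :=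
  continuous_subtype_val.continuousAt.eventually (nearby_mem_nhds (ξ := ξ.1) hσ F)

theorem exists_code_eq_subset [TopologicalSpace K] [DiscreteTopology K] [Countable K]
    {ξ : XiMin G} {P : XiMin G → Prop} (hP : ∀ᶠ η in 𝓝 ξ, P η) {π : Cantor → K}
    (hπ : Continuous π) :
    ∃ (σ : Cantor → ℕ) (F : Finset G), Continuous σ ∧ 1 ∈ F ∧
      (∀ ω ω', σ ω = σ ω' → π ω = π ω') ∧
      ∀ η : XiMin G, (∀ ω, ∀ g ∈ F, code (hom η) σ ω g = code (hom ξ) σ ω g) → P η := by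
  obtain ⟨U, hU, hUP⟩ := mem_nhds_subtype _ _ _ |>.1 hP
  obtain ⟨σ, F, h1, h2, h3, h4⟩ := exists_nearby_subset hU hπ
  exact ⟨σ, F, h1, h2, h3, fun η hη => hUP (h4 hη)⟩

theorem Stable.map {ξ : XiMin G} {σ : Cantor → K} (h : Stable ξ σ) (p : K → L) :
    Stable ξ fun ω => p (σ ω) := by
  filter_upwards [h] with η hη
  rw [range_code_map (hom η) σ p, range_code_map (hom ξ) σ p, hη]

theorem Stable.of_refines [Nonempty L] {ξ : XiMin G} {σ : Cantor → K} (h : Stable ξ σ)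
    {π : Cantor → L} (hπ : ∀ ω ω', σ ω = σ ω' → π ω = π ω') : Stable ξ π := by
  obtain ⟨p, rfl⟩ := (Function.factorsThrough_iff (g := π) (f := σ)).1 fun ω ω' => hπ ω ω'
  exact h.map p

theorem isOpen_stable (π : Cantor → K) : IsOpen {ξ : XiMin G | Stable ξ π} := by
  refine isOpen_iff_mem_nhds.2 fun ξ hξ => ?_
  filter_upwards [hξ, eventually_eventually_nhds.2 hξ] with η h1 h2
  filter_upwards [h2] with ζ h3
  rw [h3, h1]

theorem patterns_range {G K M : Type*} (F : Finset G) (u : M → G → K) :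
    patterns F (range u) = range fun ω (g : F) => u ω g :=
  (range_comp _ _).symm

/-- Closed sets of configurations are determined by their finite patterns. -/
theorem subset_of_patterns_subset {G K : Type*} [TopologicalSpace K] [DiscreteTopology K]
    {S T : Set (G → K)} (hT : IsClosed T) (h : ∀ F, patterns F S ⊆ patterns F T) : S ⊆ T := by
  intro x hx
  by_contra hxT
  obtain ⟨F, hF⟩ := exists_finset_agree (C := {x}) isCompact_singleton hT.isOpen_compl
    (singleton_subset_iff.2 hxT)
  obtain ⟨y, hy, hxy⟩ := exists_agree_of_patterns_subset (h F) hx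
  exact hF x rfl y (fun i hi => (hxy i hi).symm) hy

theorem isClosed_range_code [TopologicalSpace K] [T2Space K] (ξ : G →* (Cantor ≃ₜ Cantor))
    {π : Cantor → K} (hπ : Continuous π) : IsClosed (range (code ξ π)) :=
  (isCompact_range (continuous_code ξ hπ)).isClosed

/-- Actions close to each other generate subshifts with the same patterns on a finite set, so
generating a given subshift is a closed condition. -/
theorem isClosed_setOf_range_code_eq [TopologicalSpace K] [DiscreteTopology K] {π : Cantor → K}
    (hπ : Continuous π) {S : Set (G → K)} (hS : IsClosed S) :
    IsClosed {η : XiMin G | range (code (hom η) π) = S} := by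
  refine isOpen_compl_iff.1 (isOpen_iff_mem_nhds.2 fun η hη => ?_)
  obtain ⟨F, hF⟩ : ∃ F, patterns F (range (code (hom η) π)) ≠ patterns F S := by
    by_contra! h
    exact hη (Subset.antisymm (subset_of_patterns_subset hS fun F => (h F).subset)
      (subset_of_patterns_subset (isClosed_range_code _ hπ) fun F => (h F).superset))
  filter_upwards [eventually_code_eq η hπ F] with ζ hζ hζS
  have hζS : range (code (hom ζ) π) = S := hζS
  refine hF ?_
  rw [← hζS, patterns_range, patterns_range]
  congr 1
  funext ω g
  exact (hζ ω g g.2).symm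

/-- Stability passes to extensions. By the matching of clopen partitions, every action close to the
extension `η` has a conjugate close to `ξ`, with the labellings corresponding to each other. -/
theorem Stable.comp [TopologicalSpace K] [DiscreteTopology K] [Countable K] {ξ η : XiMin G}
    {ρ : Cantor → K} (hρ : Continuous ρ) (h : Stable ξ ρ) {j : Cantor → Cantor} (hj : Continuous j)
    (hjη : ∀ g ω, j (hom η g ω) = hom ξ g (j ω)) : Stable η fun ω => ρ (j ω) := by
  have hsurj := surjective_of_equivariant (isMinimalFlow_hom ξ) hj hjη
  obtain ⟨σ, F, hσ, hF, href, hσF⟩ := exists_code_eq_subset h hρ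
  filter_upwards [eventually_code_eq η (hσ.comp hj) F] with ζ hζ
  have hcode : ∀ ω, ∀ g ∈ F, code (hom ζ) (σ ∘ j) ω g = code (hom ξ) σ (j ω) g := fun ω g hg =>
    (hζ ω g hg).trans (congrFun (code_comp (hom η) (hom ξ) hjη σ ω) g)
  have hcont : ∀ (θ : XiMin G) {τ : Cantor → ℕ}, Continuous τ →
      Continuous fun ω (g : F) => code (hom θ) τ ω g := fun θ τ hτ =>
    continuous_pi fun g => (continuous_apply g.1).comp (continuous_code (hom θ) hτ)
  obtain ⟨f, hf⟩ := exists_homeomorph_matching cantor_not_isOpen_singleton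
    cantor_not_isOpen_singleton (hcont ζ (hσ.comp hj)) (hcont ξ hσ) (by
      rw [show (fun ω (g : F) => code (hom ζ) (σ ∘ j) ω g) =
        (fun ω (g : F) => code (hom ξ) σ ω g) ∘ j from
          funext fun ω => funext fun g => hcode ω g g.2]
      exact hsurj.range_comp _)
  have hf' : ∀ ω, ∀ g ∈ F, code (hom ξ) σ (f ω) g = code (hom ζ) (σ ∘ j) ω g := fun ω g hg =>
    congrFun (hf ω) ⟨g, hg⟩
  have hσf : ∀ ω, σ (f ω) = σ (j ω) := by
    intro ω
    have := hf' ω 1 hF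
    rwa [code_one, code_one] at this
  let θ : XiMin G := ⟨transport f (hom ζ), mem_xiMin_iff.2 ((isMinimalFlow_hom ζ).transport f)⟩
  have hfθ : ∀ g ω, f (hom ζ g ω) = hom θ g (f ω) := fun g ω => by
    show f _ = f (hom ζ g (f.symm (f ω)))
    rw [f.symm_apply_apply]
  have hθ := hσF θ (by
    intro ω g hg
    obtain ⟨ω, rfl⟩ := f.surjective ω
    rw [hf' ω g hg, ← code_comp (hom ζ) (hom θ) hfθ]
    simp only [hσf]
    rfl)
  have h1 : (fun ω => ρ (j ω)) = fun ω => ρ (f ω) := funext fun ω => href _ _ (hσf ω).symm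
  have h2 : range (code (hom ζ) fun ω => ρ (f ω)) = range (code (hom θ) ρ) := by
    rw [show (code (hom ζ) fun ω => ρ (f ω)) = code (hom θ) ρ ∘ f from
      funext fun ω => code_comp (hom ζ) (hom θ) hfθ ρ ω]
    exact f.surjective.range_comp _
  have h3 : range (code (hom η) fun ω => ρ (j ω)) = range (code (hom ξ) ρ) := by
    rw [show (code (hom η) fun ω => ρ (j ω)) = code (hom ξ) ρ ∘ j from
      funext fun ω => code_comp (hom η) (hom ξ) hjη ρ ω]
    exact hsurj.range_comp _
  rw [h3, h1, h2, hθ]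

theorem range_code_conj (f : Cantor ≃ₜ Cantor) (ξ : Xi G) {K : Type*} (π : Cantor → K) :
    range (code (G := G) (Xi.conj f ξ) π) = range (code (G := G) ξ fun ω => π (f ω)) := by
  rw [show (code (G := G) ξ fun ω => π (f ω)) = code (G := G) (Xi.conj f ξ) π ∘ f from
    funext fun ω => code_comp (G := G) ξ (Xi.conj f ξ) (j := f)
      (fun g x => by
        show f _ = f ((show G →* (Cantor ≃ₜ Cantor) from ξ) g (f.symm (f x)))
        rw [f.symm_apply_apply]) π ω]
  exact (f.surjective.range_comp _).symm

end Stable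

/-! ### A comeager conjugacy class makes projectively isolated subshifts dense -/

section Isolated

variable {G : Type*} [Group G] [Countable G] [Infinite G] {A : Type} [Finite A]

/-- A subshift generated by a labelling that is stable at `ξ` is projectively isolated: the
stability is witnessed by a finer labelling `σ` and a finite set `F`, and `σ` generates a subshift
`Z` above the given one, such that all minimal subshifts with the same patterns as `Z` on `F` have
the same image. -/
theorem isProjIsolatedMin_of_stable {ξ : XiMin G} {π : Cantor → A} (hπ : IsLocallyConstant π)
    (h : Stable ξ π) :
    IsProjIsolatedMin (subshiftOfCode (hom ξ) (isMinimalFlow_hom ξ) π hπ) := by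
  let _ : TopologicalSpace A := ⊥
  have : DiscreteTopology A := ⟨rfl⟩
  obtain ⟨σ, F, hσ, hF, href, hσF⟩ := exists_code_eq_subset h hπ.continuous
  have hfin : Finite (range σ) := (isCompact_range hσ).finite_of_discrete
  -- The second component makes the projection to `A` surjective.
  let τ : Cantor → range σ × A := fun ω => (⟨σ ω, mem_range_self ω⟩, π ω)
  have hτc : Continuous τ := (hσ.subtype_mk _).prodMk hπ.continuous
  have hτ : IsLocallyConstant τ := (IsLocallyConstant.iff_continuous _).2 hτc
  have hp : Function.Surjective (Prod.snd : range σ × A → A) := fun a =>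
    ⟨(⟨σ default, mem_range_self _⟩, a), rfl⟩
  refine ⟨range σ × A, inferInstance, _, isFactorMap_letters hp,
    {Y | patterns F (points Y) = patterns F (range (code (hom ξ) τ))}, isOpen_patterns_eq F _,
    ⟨subshiftOfCode (hom ξ) (isMinimalFlow_hom ξ) τ hτ, rfl⟩, fun Y hY => ?_⟩
  have hr : Continuous fun (u : FullShift G (range σ × A)) (g : F) => (u g : range σ × A) :=
    continuous_pi fun g => continuous_eval g.1
  obtain ⟨η, hη, τ', hτ', hY', hcode⟩ := exists_cantor_code Y hr
    (ρ := fun ω (g : F) => code (hom ξ) τ ω g)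
    (continuous_pi fun g => (continuous_apply g.1).comp (continuous_code (hom ξ) hτc))
    (by rw [← patterns_range]; exact hY)
  obtain rfl : τ' = τ := by
    funext ω
    have := congrFun (hcode ω) ⟨1, hF⟩
    simpa only [codeShift, code_one] using this
  have h1 := hσF ⟨η, mem_xiMin_iff.2 hη⟩ fun ω g hg =>
    congrArg (fun a => (a.1 : ℕ)) (congrFun (hcode ω) ⟨g, hg⟩)
  show _ '' points Y = range (code (hom ξ) π)
  rw [← hY', ← h1]
  exact (range_code_map η τ Prod.snd).symm

/-- A generic action generates only countably many subshifts, so by Baire's theorem a given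
labelling is stable at many actions. -/
theorem dense_isProjIsolatedMin (h : HasComeagerConjClassMin G) :
    Dense {X : SMin G (FullShift G A) | IsProjIsolatedMin X} := by
  let _ : TopologicalSpace A := ⊥
  have : DiscreteTopology A := ⟨rfl⟩
  obtain ⟨ξ₀, -, hres⟩ := h
  refine dense_iff_inter_open.2 fun U hU ⟨X, hX⟩ => ?_
  obtain ⟨ξ, hξ, π, hπ, hξX, -⟩ := exists_cantor_code X (r := fun _ => ()) continuous_const
    (ρ := fun _ => ()) continuous_const (by
      rw [Nonempty.image_const X.1.1.nonempty, range_const])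
  obtain ⟨F, hF⟩ := exists_patterns_subset (hU.mem_nhds hX)
  let T : C(Cantor, A) → Set (XiMin G) := fun π' =>
    {η | range (code (hom η) π) = range (code (G := G) ξ₀ π')}
  -- The frontier of a closed set is nowhere dense.
  have hT : ∀ π', ∀ᶠ η in residual (XiMin G), η ∈ T π' → η ∈ interior (T π') := by
    intro π'
    have hcl : IsClosed (T π') := isClosed_setOf_range_code_eq hπ.continuous
      (isClosed_range_code _ π'.continuous)
    refine mem_of_superset (residual_of_dense_open isClosed_frontier.isOpen_compl
      (interior_eq_empty_iff_dense_compl.1 (interior_frontier hcl))) fun η hη hηT => ?_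
    by_contra hi
    exact hη ⟨subset_closure hηT, hi⟩
  have hV := (eventually_code_eq ⟨ξ, mem_xiMin_iff.2 hξ⟩ hπ.continuous F)
  obtain ⟨η, hηV, ⟨f, hf⟩, hη⟩ := (mem_closure_iff_nhds.1
    (dense_of_mem_residual ((eventually_countable_forall.2 hT).and hres |>.mono
      fun η hη => (⟨hη.2, hη.1⟩ : η.1 ∈ Xi.conjClass ξ₀ ∧ ∀ π', η ∈ T π' → η ∈ interior (T π')))
      ⟨ξ, mem_xiMin_iff.2 hξ⟩)) _ hV
  have hηT : η ∈ T ⟨fun ω => π (f ω), hπ.continuous.comp f.continuous⟩ := by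
    show range (code (hom η) π) = _
    rw [show hom η = Xi.conj f ξ₀ from hf.symm]
    exact range_code_conj f ξ₀ π
  have hst : Stable η π := by
    filter_upwards [mem_interior_iff_mem_nhds.1 (hη _ hηT)] with ζ hζ
    exact Eq.trans hζ (Eq.symm hηT)
  refine ⟨subshiftOfCode (hom η) (isMinimalFlow_hom η) π hπ, hF _ ?_,
    isProjIsolatedMin_of_stable hπ hst⟩
  rw [← hξX, points_ofCode]
  refine (patterns_range F _).trans (Eq.trans ?_ (patterns_range F _).symm)
  congr 1
  funext ω g
  exact hηV ω g g.2

end Isolated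

/-! ### Dense projectively isolated subshifts make a conjugacy class comeager -/

section Generic

variable {G : Type*} [Group G] [Countable G] [Infinite G]

/-- If projectively isolated subshifts are dense, then each labelling is stable at a dense set of
actions: perturb the given action so that its labelling generates a projectively isolated subshift
`X`, by means of an extension of some subshift `Y` in the open set that witnesses isolation. -/
theorem exists_stable (h : ∀ (A : Type) [Finite A],
      Dense {X : SMin G (FullShift G A) | IsProjIsolatedMin X})
    {ξ : XiMin G} {U : Set (XiMin G)} (hU : U ∈ 𝓝 ξ) {π : Cantor → ℕ} (hπ : Continuous π) :
    ∃ η ∈ U, Stable η π := by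
  classical
  obtain ⟨σ, F, hσ, hF, href, hσF⟩ := exists_code_eq_subset (P := (· ∈ U)) hU hπ
  have hfin : Finite (range σ) := (isCompact_range hσ).finite_of_discrete
  let τ : Cantor → range σ := fun ω => ⟨σ ω, mem_range_self ω⟩
  have hτc : Continuous τ := hσ.subtype_mk _
  have hτ : IsLocallyConstant τ := (IsLocallyConstant.iff_continuous _).2 hτc
  obtain ⟨X, hX, B, _, Φ, hΦ, V, hV, ⟨Y, hY⟩, hVX⟩ := (h (range σ)).inter_open_nonempty _
    (isOpen_patterns_eq F (patterns F (range (codeShift (hom ξ) τ))))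
    ⟨subshiftOfCode (hom ξ) (isMinimalFlow_hom ξ) τ hτ, rfl⟩
  obtain ⟨E, hE⟩ := exists_block hΦ.continuous
  obtain ⟨D, hD⟩ := exists_patterns_subset (hV.mem_nhds hY)
  have hr : Continuous fun (u : FullShift G B) (g : F) => (Φ u g : range σ) :=
    continuous_pi fun g => (continuous_eval g.1).comp hΦ.continuous
  obtain ⟨η, hη, θ, hθ, hθY, hcode⟩ := exists_cantor_code Y hr
    (ρ := fun ω (g : F) => code (hom ξ) τ ω g)
    (continuous_pi fun g => (continuous_apply g.1).comp (continuous_code (hom ξ) hτc))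
    (by
      rw [← patterns_range]
      refine Eq.trans ?_ hX
      rw [show points X = Φ '' points Y from (hVX Y hY).symm]
      exact (image_image (fun (u : FullShift G (range σ)) (g : F) => u g) Φ (points Y)).symm)
  have hθτ : ∀ ω, Φ (codeShift η θ ω) 1 = τ ω := fun ω => by
    have := congrFun (hcode ω) ⟨1, hF⟩
    simpa only [code_one] using this
  have hητ : ∀ ω, codeShift η τ ω = Φ (codeShift η θ ω) := fun ω => by
    rw [← map_code η hΦ.equivariant, funext hθτ]
  let η' : XiMin G := ⟨η, mem_xiMin_iff.2 hη⟩
  refine ⟨η', hσF η' fun ω g hg => ?_, ?_⟩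
  · have h1 := congrFun (hcode ω) ⟨g, hg⟩
    have h2 := congrFun (hητ ω) g
    exact congrArg Subtype.val (h2.trans h1)
  · have : Nonempty (range σ) := ⟨τ default⟩
    suffices hst : Stable η' τ from
      hst.of_refines fun ω ω' hω => href ω ω' (congrArg Subtype.val hω)
    let _ : TopologicalSpace B := ⊥
    have : DiscreteTopology B := ⟨rfl⟩
    have hX' : ∀ ζ : XiMin G, (∀ ω, codeShift (hom ζ) τ ω = Φ (codeShift (hom ζ) θ ω)) →
        range (codeShift (hom ζ) τ) = Φ '' range (codeShift (hom ζ) θ) := fun ζ hζ => by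
      rw [funext hζ]
      exact range_comp Φ (codeShift (hom ζ) θ)
    filter_upwards [eventually_code_eq η' hθ.continuous (D ∪ E)] with ζ hζ
    have hζτ : ∀ ω, codeShift (hom ζ) τ ω = Φ (codeShift (hom ζ) θ ω) := fun ω => by
      rw [← map_code (hom ζ) hΦ.equivariant]
      congr 1
      funext ω
      rw [← hθτ]
      exact (hE _ _ fun g hg => hζ ω g (Finset.mem_union_right _ hg)).symm
    have hζV : subshiftOfCode (hom ζ) (isMinimalFlow_hom ζ) θ hθ ∈ V := by
      refine hD _ ?_
      rw [points_ofCode, ← hθY]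
      refine (patterns_range D _).trans (Eq.trans ?_ (patterns_range D _).symm)
      congr 1
      funext ω g
      exact hζ ω g (Finset.mem_union_left _ g.2)
    refine (hX' ζ hζτ).trans (Eq.trans ?_ (hX' η' hητ).symm)
    rw [show range (codeShift (hom η') θ) = points Y from hθY]
    exact (hVX _ hζV).trans (hVX Y hY).symm

omit [Countable G] [Infinite G] in
theorem residual_stable_of_dense (π : Cantor → ℕ)
    (h : ∀ (ξ : XiMin G), ∀ U ∈ 𝓝 ξ, ∃ η ∈ U, Stable η π) :
    ∀ᶠ ξ in residual (XiMin G), Stable ξ π :=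
  residual_of_dense_open (isOpen_stable π) fun ξ => mem_closure_iff_nhds.2 fun U hU => by
    obtain ⟨η, hη, hs⟩ := h ξ U hU
    exact ⟨η, hη, hs⟩

variable (G) in
/-- The subshifts over the alphabet `ℕ` that are generated by stable labellings. -/
def stableShifts : Set (Set (G → ℕ)) :=
  {S | ∃ (ρ : C(Cantor, ℕ)) (ξ : XiMin G), Stable ξ ρ ∧ range (code (hom ξ) ρ) = S}

instance : SecondCountableTopology (Xi G) := isInducing_toMaps.secondCountableTopology

omit [Infinite G] in
/-- For each labelling, the actions at which the labelling stably generates `S` form, for varying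
`S`, disjoint open sets. -/
theorem countable_stableShifts : (stableShifts G).Countable := by
  have : stableShifts G = ⋃ ρ : C(Cantor, ℕ),
      {S | ∃ ξ : XiMin G, Stable ξ ρ ∧ range (code (hom ξ) ρ) = S} := by
    ext S
    simp [stableShifts]
  rw [this]
  refine countable_iUnion fun ρ => ?_
  refine PairwiseDisjoint.countable_of_isOpen
    (s := fun S => interior {η : XiMin G | range (code (hom η) ρ) = S}) ?_
    (fun _ _ => isOpen_interior) ?_
  · intro S _ T _ hST
    refine disjoint_left.2 fun η hS hT => hST ?_
    have hS' : η ∈ {η : XiMin G | range (code (hom η) ρ) = S} := interior_subset hS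
    have hT' : η ∈ {η : XiMin G | range (code (hom η) ρ) = T} := interior_subset hT
    exact (Eq.symm hS').trans hT'
  · rintro S ⟨ξ, hξ, rfl⟩
    exact ⟨ξ, mem_interior_iff_mem_nhds.2 hξ⟩

/-- Labels in `ℕ` are refined by pairs, coded by numbers: the old label is the first component.
`Extends η π S` says that if `π` generates, under `η`, the image of `S` under this projection, then
`π` is refined in this way by a labelling that generates `S`. -/
def Extends (η : XiMin G) (π : Cantor → ℕ) (S : Set (G → ℕ)) : Prop :=
  range (code (hom η) π) = (fun u g => (Nat.unpair (u g)).1) '' S →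
    ∃ ρ : Cantor → ℕ, Continuous ρ ∧ (∀ ω, (Nat.unpair (ρ ω)).1 = π ω) ∧
      range (code (hom η) ρ) = S

omit [Countable G] [Infinite G] in
/-- The extension property for stable subshifts holds on a dense open set: a joining of `η` with an
action generating `S` is close to `η`, has the wanted labelling, and that labelling is stable. -/
theorem residual_extends (π : C(Cantor, ℕ)) {S : Set (G → ℕ)} (hS : S ∈ stableShifts G) :
    ∀ᶠ η in residual (XiMin G), Extends η π S := by
  obtain ⟨ρ, ξ, hst, rfl⟩ := hS
  have hp : Continuous fun n : ℕ => (Nat.unpair n).1 := continuous_of_discreteTopology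
  have hpρ : Continuous fun ω => (Nat.unpair (ρ ω)).1 := hp.comp ρ.continuous
  have himage := range_code_map (hom ξ) ρ fun n => (Nat.unpair n).1
  refine mem_of_superset (residual_of_dense_open
    (isOpen_interior (s := {η | Extends η π (range (code (hom ξ) ρ))}))
    fun η => mem_closure_iff_nhds.2 fun U hU => ?_) interior_subset
  by_cases heq : range (code (hom η) π) = range (code (hom ξ) fun ω => (Nat.unpair (ρ ω)).1)
  · obtain ⟨σ, F, hσ, hF, href, hσF⟩ := exists_code_eq_subset (P := (· ∈ U)) hU π.continuous
    obtain ⟨ζ, hζ, j₁, j₂, hj₁, hj₂, hj₁ζ, hj₂ζ, hj, hjF⟩ := exists_cantor_joining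
      (isMinimalFlow_hom η) π.continuous hpρ heq hσ F
    let ζ' : XiMin G := ⟨ζ, mem_xiMin_iff.2 hζ⟩
    have hσj : ∀ ω, σ (j₁ ω) = σ ω := fun ω => by
      have := hjF ω 1 hF
      rwa [code_one, code_one] at this
    have hπj : ∀ ω, (Nat.unpair (ρ (j₂ ω))).1 = π ω := fun ω => by
      have := congrFun (hj ω) 1
      rw [code_one, code_one] at this
      rw [← this]
      exact href _ _ (hσj ω)
    refine ⟨ζ', hσF ζ' fun ω g hg => ?_, mem_interior_iff_mem_nhds.2 ?_⟩
    · rw [← hjF ω g hg, ← code_comp ζ (hom η) hj₁ζ]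
      simp only [hσj]
      rfl
    · have hρj : range (code (hom ζ') fun ω => ρ (j₂ ω)) = range (code (hom ξ) ρ) := by
        rw [show (code (hom ζ') fun ω => ρ (j₂ ω)) = code (hom ξ) ρ ∘ j₂ from
          funext fun ω => code_comp ζ (hom ξ) hj₂ζ ρ ω]
        exact (surjective_of_equivariant (isMinimalFlow_hom ξ) hj₂ hj₂ζ).range_comp _
      filter_upwards [hst.comp (η := ζ') ρ.continuous hj₂ hj₂ζ] with θ hθ _
      exact ⟨fun ω => ρ (j₂ ω), ρ.continuous.comp hj₂, hπj, hθ.trans hρj⟩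
  · refine ⟨η, mem_of_mem_nhds hU, mem_interior_iff_mem_nhds.2 ?_⟩
    filter_upwards [(isClosed_setOf_range_code_eq π.continuous
      (isClosed_range_code (hom ξ) hpρ)).isOpen_compl.mem_nhds heq] with θ hθ h
    exact absurd (h.trans himage.symm) hθ

/-- The minimal actions at which all labellings are stable, and which satisfy the extension property
with respect to all subshifts generated by stable labellings. -/
def Generic (ξ : XiMin G) : Prop :=
  (∀ π : C(Cantor, ℕ), Stable ξ π) ∧ ∀ π : C(Cantor, ℕ), ∀ S ∈ stableShifts G, Extends ξ π S

open Classical in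
omit [Countable G] [Infinite G] in
/-- The step of the back-and-forth between generic actions. -/
theorem Generic.exists_refinement {ξ η : XiMin G} (hξ : Generic ξ) (hη : Generic η)
    {π π' : C(Cantor, ℕ)} (h : range (code (hom ξ) π) = range (code (hom η) π')) {s : Set Cantor}
    (hs : IsClopen s) :
    ∃ ρ ρ' : C(Cantor, ℕ), range (code (hom ξ) ρ) = range (code (hom η) ρ') ∧
      (∀ x y, code (hom ξ) ρ x = code (hom η) ρ' y → code (hom ξ) π x = code (hom η) π' y) ∧
      ∀ x x', code (hom ξ) ρ x = code (hom ξ) ρ x' → (x ∈ s ↔ x' ∈ s) := by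
  have hs' : Continuous fun ω => if ω ∈ s then 1 else 0 :=
    (LocallyConstant.charFn ℕ hs).continuous.congr fun ω => by
      simp [LocallyConstant.coe_charFn, indicator_apply]
  have hc : Continuous fun ω => Nat.pair (π ω) (if ω ∈ s then 1 else 0) :=
    (continuous_of_discreteTopology (f := fun p : ℕ × ℕ => Nat.pair p.1 p.2)).comp
      (π.continuous.prodMk hs')
  let ρ : C(Cantor, ℕ) := ⟨_, hc⟩
  have hρ : ∀ ω, (Nat.unpair (ρ ω)).1 = π ω := fun ω => by simp [ρ]
  obtain ⟨ρ', hρ'c, hρ'π, hρ'⟩ := hη.2 π' (range (code (hom ξ) ρ)) ⟨ρ, ξ, hξ.1 ρ, rfl⟩ (by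
    rw [← h, ← range_code_map (hom ξ) ρ fun n => (Nat.unpair n).1, funext hρ])
  refine ⟨ρ, ⟨ρ', hρ'c⟩, hρ'.symm, fun x y hxy => ?_, fun x x' hxx' => ?_⟩
  · funext g
    have := congrArg (fun n => (Nat.unpair n).1) (congrFun hxy g)
    simpa only [code, hρ, ContinuousMap.coe_mk, hρ'π] using this
  · have := congrFun hxx' 1
    rw [code_one, code_one] at this
    have := congrArg (fun n => (Nat.unpair n).2) this
    simp only [ρ, ContinuousMap.coe_mk, Nat.unpair_pair] at this
    by_cases h1 : x ∈ s <;> by_cases h2 : x' ∈ s <;> simp_all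

omit [Countable G] [Infinite G] in
theorem Generic.conj {ξ η : XiMin G} (hξ : Generic ξ) (hη : Generic η) :
    η.1 ∈ Xi.conjClass ξ.1 := by
  obtain ⟨f, q, ρ, -, -, hP, hf, hsep⟩ := exists_homeomorph_of_backAndForth
    (P := fun q ρ : Cantor → G → ℕ => ∃ π π' : C(Cantor, ℕ), q = code (hom ξ) π ∧
      ρ = code (hom η) π' ∧ range q = range ρ)
    (by
      rintro _ _ ⟨π, π', rfl, rfl, h⟩
      exact ⟨continuous_code _ π.continuous, continuous_code _ π'.continuous, h⟩)
    (by
      rintro _ _ ⟨π, π', rfl, rfl, h⟩ s hs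
      obtain ⟨σ, σ', h1, h2, h3⟩ := hξ.exists_refinement hη h hs
      exact ⟨_, _, ⟨σ, σ', rfl, rfl, h1⟩, h2, h3⟩)
    (by
      rintro _ _ ⟨π, π', rfl, rfl, h⟩ s hs
      obtain ⟨σ', σ, h1, h2, h3⟩ := hη.exists_refinement hξ h.symm hs
      exact ⟨_, _, ⟨σ, σ', rfl, rfl, h1.symm⟩, fun x y hxy => (h2 y x hxy.symm).symm, h3⟩)
    (code (hom ξ) fun _ => 0) (code (hom η) fun _ => 0)
    ⟨ContinuousMap.const _ 0, ContinuousMap.const _ 0, rfl, rfl, rfl⟩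
  have hfg : ∀ g ω, f (hom ξ g ω) = hom η g (f ω) := by
    intro g ω
    refine hsep _ _ fun n => ?_
    rw [hf]
    obtain ⟨π, π', hq, hρ, -⟩ := hP n
    have hn := hf n ω
    rw [hq, hρ] at hn ⊢
    funext h
    rw [code_flow, code_flow, hn]
  refine ⟨f, ?_⟩
  refine MonoidHom.ext (M := G) (N := Cantor ≃ₜ Cantor) fun g => Homeomorph.ext fun ω => ?_
  show f (hom ξ g (f.symm ω)) = hom η g ω
  rw [hfg, f.apply_symm_apply]

theorem hasComeagerConjClassMin_of_dense (h : ∀ (A : Type) [Finite A],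
      Dense {X : SMin G (FullShift G A) | IsProjIsolatedMin X}) :
    HasComeagerConjClassMin G := by
  have hgen : ∀ᶠ ξ in residual (XiMin G), Generic ξ := by
    refine (eventually_countable_forall.2 fun π : C(Cantor, ℕ) =>
      residual_stable_of_dense π fun ξ U hU => exists_stable h hU π.continuous).and
      (eventually_countable_forall.2 fun π => ?_)
    exact (eventually_countable_ball countable_stableShifts).2 fun S hS => residual_extends π hS
  have := nonempty_xiMin (G := G)
  obtain ⟨ξ, hξ⟩ := (dense_of_mem_residual hgen).nonempty
  exact ⟨ξ.1, ξ.2, mem_of_superset hgen fun η hη => Generic.conj hξ hη⟩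

end Generic

end GenericMinimal

theorem corollary3p6 (G : Type*) [Group G] [Countable G] [Infinite G] :
    GenericMinimal.HasComeagerConjClassMin G ↔
      ∀ (A : Type) [Finite A],
        Dense {X : GenericMinimal.SMin G (GenericMinimal.FullShift G A) |
          GenericMinimal.IsProjIsolatedMin X} :=
  ⟨fun h _ _ => GenericMinimal.dense_isProjIsolatedMin h,
    GenericMinimal.hasComeagerConjClassMin_of_dense⟩
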